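/- **Setting.** Let $r\ge 1$ and $n\ge 1$, and work in the field $\mathbb{C}(u_1,\dots,u_r,q)$, where $u_1,\dots,u_r,q$ are indeterminates. Let $\mu=(\mu^{(1)},\dots,\mu^{(r)})$ and $\nu=(\nu^{(1)},\dots,\nu^{(r)})$ be $r$-tuples of partitions with $\nu^{(m)}\subseteq\mu^{(m)}$ for all $m$, and let $\lambda=\mu/\nu=(\mu^{(1)}/\nu^{(1)},\dots,\mu^{(r)}/\nu^{(r)})$ be the corresponding (possibly skew) $r$-shape; assume that it has $n$ boxes in total. Rows and columns are labelled as for matrices. The content of a box $b$ in row $i$ and column $j$ of $\lambda^{(m)}$ is $\mathrm{ct}(b)=u_m q^{2(j-i)}$. A standard tableau $L$ of shape $\lambda$ is a filling of the boxes of $\lambda$ with the numbers $1,\dots,n$, each used once, that increases from left to right along the rows and from top to bottom along the columns of each $\lambda^{(m)}$; $L(i)$ is the box that contains $i$. For $0\le k\le r-1$ put $$\Delta^{(k)}(L)=\mathrm{ct}(L(1))^k\prod_{i=2}^{n}\frac{q-q^{-1}}{1-\mathrm{ct}(L(i-1))/\mathrm{ct}(L(i))},\qquad \Delta^{(k)}(\lambda)=\sum_{L}\Delta^{(k)}(L),$$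 where the sum is over all standard tableaux $L$ of shape $\lambda$. Two boxes of the same $\lambda^{(m)}$ are adjacent if they share an edge. Let $\mathrm{CC}$ be the set of connected components of $\lambda$ under adjacency and $cc=|\mathrm{CC}|$; for $bs\in\mathrm{CC}$ let $r(bs)$ and $c(bs)$ be the number of rows and the number of columns that $bs$ occupies. The shape $\lambda$ is a broken border strip if it contains no $2\times2$ block of boxes. Let $\mathrm{SC}$ be the set of sharp corners of $\lambda$ (boxes with no box directly above and no box directly to the left), and $\mathrm{DC}$ the set of dull corners (boxes with a box directly to the left and a box directly above, but no box directly northwest). Let $e_t(\mathrm{ct}(\mathrm{DC}))$ be the elementary symmetric function of degree $t$ in the variables $\mathrm{ct}(d)$, $d\in\mathrm{DC}$, and $h_m(\mathrm{ct}(\mathrm{SC}))$ the complete homogeneous symmetric function of degree $m$ in the variables $\mathrm{ct}(s)$, $s\in\mathrm{SC}$, with $h_0=1$ and $h_m=0$ for $m<0$. **Theorem 2.17.** (a) If $\lambda$ is not a broken border strip, then $\Delta^{(k)}(\lambda)=0$ for all $0\le k\le r-1$. (b) If $\lambda$ is a broken border strip, then $$\Delta^{(0)}(\lambda)=(q-q^{-1})^{cc-1}\prod_{bs\in\mathrm{CC}}q^{c(bs)-1}(-q^{-1})^{r(bs)-1},$$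 and, for $1\le k\le r-1$, $$\Delta^{(k)}(\lambda)=(-q+q^{-1})^{cc-1}\Big(\prod_{s\in\mathrm{SC}}\mathrm{ct}(s)\Big)\Big(\prod_{d\in\mathrm{DC}}\mathrm{ct}(d)^{-1}\Big)\Big(\sum_{t=0}^{|\mathrm{DC}|}(-1)^t e_t(\mathrm{ct}(\mathrm{DC}))\,h_{k-t-cc}(\mathrm{ct}(\mathrm{SC}))\Big)\prod_{bs\in\mathrm{CC}}q^{c(bs)-1}(-q^{-1})^{r(bs)-1}.$$ -/

import Mathlib

open scoped BigOperators

noncomputable section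

namespace CyclotomicMN

/-- The field `ℂ(u₁, …, u_r, q)`: `Sum.inl m` indexes `u_m` and `Sum.inr ()` indexes `q`. -/
abbrev RatField (r : ℕ) : Type := FractionRing (MvPolynomial (Fin r ⊕ Unit) ℂ)

/-- The indeterminate `u_m`. -/
def u {r : ℕ} (m : Fin r) : RatField r :=
  algebraMap (MvPolynomial (Fin r ⊕ Unit) ℂ) (RatField r) (MvPolynomial.X (Sum.inl m))

/-- The indeterminate `q`. -/
def q {r : ℕ} : RatField r :=
  algebraMap (MvPolynomial (Fin r ⊕ Unit) ℂ) (RatField r) (MvPolynomial.X (Sum.inr ()))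

/-- A position in an `r`-tuple of diagrams: `(m, i, j)` is row `i`, column `j` of the `m`-th
diagram. Rows and columns are labelled as for matrices and, following `YoungDiagram`,
counted from `0`; only differences of them ever matter. -/
abbrev Box (r : ℕ) : Type := Fin r × ℕ × ℕ

/-- The index of the diagram which contains the position. -/
abbrev Box.comp {r : ℕ} (b : Box r) : Fin r := b.1

/-- The row of the position. -/
abbrev Box.row {r : ℕ} (b : Box r) : ℕ := b.2.1

/-- The column of the position. -/
abbrev Box.col {r : ℕ} (b : Box r) : ℕ := b.2.2

/-- The content `ct(b) = u_m q^{2(j - i)}` of a box `b` in row `i` and column `j` of the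
`m`-th diagram. -/
def ct {r : ℕ} (b : Box r) : RatField r :=
  u b.comp * q ^ (2 * ((b.col : ℤ) - (b.row : ℤ)))

/-- A (possibly skew) `r`-shape `outer / inner`, given by two `r`-partitions with
`inner ⊆ outer`. The `r`-partitions themselves are the case in which all `inner m` are empty. -/
structure Shape (r : ℕ) where
  outer : Fin r → YoungDiagram
  inner : Fin r → YoungDiagram
  inner_le_outer : ∀ m, inner m ≤ outer m

namespace Shape

variable {r : ℕ}

/-- The set of boxes of a shape. -/
def boxes (S : Shape r) : Finset (Box r) :=
  Finset.univ.biUnion fun m : Fin r =>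
    ((S.outer m).cells \ (S.inner m).cells).image fun c => ((m, c.1, c.2) : Box r)

/-- Two boxes are adjacent when they are in the same diagram and share an edge, that is, they
are consecutive in a row or consecutive in a column. -/
def adjGraph (S : Shape r) : SimpleGraph {b : Box r // b ∈ S.boxes} where
  Adj a b := a.1.comp = b.1.comp ∧
    ((a.1.row = b.1.row ∧ (a.1.col + 1 = b.1.col ∨ b.1.col + 1 = a.1.col)) ∨
      (a.1.col = b.1.col ∧ (a.1.row + 1 = b.1.row ∨ b.1.row + 1 = a.1.row)))
  symm := ⟨fun a b h => by
    obtain ⟨h1, h2⟩ := h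
    refine ⟨h1.symm, ?_⟩
    rcases h2 with ⟨h3, h4⟩ | ⟨h3, h4⟩
    · exact Or.inl ⟨h3.symm, h4.symm⟩
    · exact Or.inr ⟨h3.symm, h4.symm⟩⟩
  loopless := ⟨fun a h => by
    rcases h.2 with ⟨_, h4⟩ | ⟨_, h4⟩ <;> omega⟩

/-- The connected components of a shape. -/
abbrev Component (S : Shape r) : Type := S.adjGraph.ConnectedComponent

instance (S : Shape r) : Fintype S.Component :=
  @Fintype.ofFinite _ (Quot.finite _)

/-- The number of connected components of a shape. -/
def cc (S : Shape r) : ℕ := Fintype.card S.Component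

open Classical in
/-- The set of boxes of a connected component. -/
def componentBoxes (S : Shape r) (C : S.Component) : Finset (Box r) :=
  (Finset.univ.filter fun b : {b : Box r // b ∈ S.boxes} =>
    S.adjGraph.connectedComponentMk b = C).image Subtype.val

/-- The number of rows which a connected component meets. -/
def numRows (S : Shape r) (C : S.Component) : ℕ :=
  ((S.componentBoxes C).image Box.row).card

/-- The number of columns which a connected component meets. -/
def numCols (S : Shape r) (C : S.Component) : ℕ :=
  ((S.componentBoxes C).image Box.col).card

/-- A broken border strip is a shape that contains no `2 × 2` block of boxes. -/
def IsBrokenBorderStrip (S : Shape r) : Prop :=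
  ¬ ∃ (m : Fin r) (i j : ℕ), (m, i, j) ∈ S.boxes ∧ (m, i, j + 1) ∈ S.boxes ∧
    (m, i + 1, j) ∈ S.boxes ∧ (m, i + 1, j + 1) ∈ S.boxes

/-- There is a box of the shape directly above the position `b`. -/
def HasAbove (S : Shape r) (b : Box r) : Prop :=
  ∃ i : ℕ, i + 1 = b.row ∧ (b.comp, i, b.col) ∈ S.boxes

/-- There is a box of the shape directly to the left of the position `b`. -/
def HasLeft (S : Shape r) (b : Box r) : Prop :=
  ∃ j : ℕ, j + 1 = b.col ∧ (b.comp, b.row, j) ∈ S.boxes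

/-- There is a box of the shape directly northwest of the position `b`. -/
def HasNorthwest (S : Shape r) (b : Box r) : Prop :=
  ∃ i j : ℕ, i + 1 = b.row ∧ j + 1 = b.col ∧ (b.comp, i, j) ∈ S.boxes

open Classical in
/-- The sharp corners: the boxes with no box above and no box to the left. -/
def SC (S : Shape r) : Finset (Box r) :=
  S.boxes.filter fun b => ¬ S.HasAbove b ∧ ¬ S.HasLeft b

open Classical in
/-- The dull corners: the boxes with a box to the left and a box above, but no box directly
northwest. -/
def DC (S : Shape r) : Finset (Box r) :=
  S.boxes.filter fun b => S.HasLeft b ∧ S.HasAbove b ∧ ¬ S.HasNorthwest b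

/-- A filling of the boxes of `S` by `n` numbers, each used once, is standard when the entries
increase from left to right along each row and from top to bottom along each column of every
diagram. -/
def IsStandard (S : Shape r) {n : ℕ} (f : {b : Box r // b ∈ S.boxes} ≃ Fin n) : Prop :=
  (∀ a b : {b : Box r // b ∈ S.boxes}, a.1.comp = b.1.comp → a.1.row = b.1.row →
    a.1.col < b.1.col → f a < f b) ∧
  (∀ a b : {b : Box r // b ∈ S.boxes}, a.1.comp = b.1.comp → a.1.col = b.1.col →
    a.1.row < b.1.row → f a < f b)

/-- The standard tableaux of shape `S` with `n` boxes. The entries `1, …, n` are represented by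
the elements `0, …, n - 1` of `Fin n`. -/
abbrev StandardTableau (S : Shape r) (n : ℕ) : Type :=
  {f : {b : Box r // b ∈ S.boxes} ≃ Fin n // S.IsStandard f}

instance (S : Shape r) (n : ℕ) : Fintype (S.StandardTableau n) :=
  Fintype.ofFinite _

/-- The box of the tableau `L` which contains the entry `i`. -/
def StandardTableau.box {S : Shape r} {n : ℕ} (L : S.StandardTableau n) (i : Fin n) : Box r :=
  (L.1.symm i).1

/-- `Δ^{(k)}(L) = ct(L(1))^k ∏_{i = 2}^{n} (q - q⁻¹) / (1 - ct(L(i - 1)) / ct(L(i)))` for a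
standard tableau `L` with `n = p + 1` boxes. -/
def StandardTableau.delta {S : Shape r} {p : ℕ} (k : ℕ) (L : S.StandardTableau (p + 1)) :
    RatField r :=
  ct (L.box 0) ^ k *
    ∏ i : Fin p, (q - q⁻¹) / (1 - ct (L.box i.castSucc) / ct (L.box i.succ))

/-- `Δ^{(k)}(S)`, the sum of `Δ^{(k)}(L)` over all standard tableaux `L` of shape `S`, for a
shape with `p + 1` boxes. -/
def delta (S : Shape r) (p k : ℕ) : RatField r :=
  ∑ L : S.StandardTableau (p + 1), StandardTableau.delta k L

/-- `∏_{bs} q^{c(bs) - 1} (-q⁻¹)^{r(bs) - 1}`, the product over the connected components. -/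
def stripProduct (S : Shape r) : RatField r :=
  ∏ C : S.Component,
    q ^ ((S.numCols C : ℤ) - 1) * (-q⁻¹) ^ ((S.numRows C : ℤ) - 1)

end Shape

/-- `e_t(ct(A))`, the elementary symmetric function of degree `t` in the variables `ct(a)`,
`a ∈ A`. -/
def elemSymm {r : ℕ} (A : Finset (Box r)) (t : ℕ) : RatField r :=
  MvPolynomial.aeval (fun a : {b : Box r // b ∈ A} => ct a.1)
    (MvPolynomial.esymm {b : Box r // b ∈ A} ℤ t)

/-- `h_m(ct(A))`, the complete homogeneous symmetric function of degree `m` in the variables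
`ct(a)`, `a ∈ A`, which is `0` for negative `m` (and `1` for `m = 0`). -/
def homSymm {r : ℕ} (A : Finset (Box r)) : ℤ → RatField r
  | Int.ofNat m => MvPolynomial.aeval (fun a : {b : Box r // b ∈ A} => ct a.1)
      (MvPolynomial.hsymm {b : Box r // b ∈ A} ℤ m)
  | Int.negSucc _ => 0

end CyclotomicMN

end

/-! If `x` and `y` are the contents of consecutive boxes of a tableau, the corresponding factor of
its weight is `-(q - q⁻¹) * y * (x - y)⁻¹`. Collecting the factors `y` leaves a constant times a sum
over linear extensions: a chain of reciprocal differences, weighted by the `(k - 1)`-st power of the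
content of the first box.

Such sums are evaluated by a form of Greene's theorem, `IsConvex.sum_chainWeight`. With one more
factor `(z - x (w 0))⁻¹` in front of the chain, the sum is a product over edges, which vanishes if
there is a `2 × 2` block, times `∏ (z - x d) / ∏ (z - x s)` over dull corners `d` and sharp corners
`s`. The proof is an induction: a linear extension starts at a sharp corner `s`, and the formula for
the shape without `s`, taken at `z = x s`, is the coefficient of `(z - x s)⁻¹` in the partial
fraction expansion of the claim (`IsConvex.edgeProd_mul_prod_erase`). The expansion has no
polynomial part because there are fewer dull than sharp corners.

This gives `Shape.delta_eq_edgeProd_mul` and hence (a). For (b) there remains a sum over sharp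
corners of powers times partial fraction coefficients. For `k ≥ 1` it is expressed by symmetric
functions through Lagrange interpolation (`sum_pow_mul_prod_div_prod`); for `k = 0` it is the
partial fraction identity at `z = 0`. The number of sharp minus dull corners is the number of
components (`Shape.card_SC`), which explains the shift of the index of `h` and the sign at `k = 0`.
The powers of `q` come from the horizontal and vertical edges (`Shape.delta_eq_stripProduct_mul`).
-/

noncomputable section

namespace CyclotomicMN

/-! ### Partial fractions and symmetric functions. -/

section SymmetricFunctions

variable {ι K : Type*} [Field K]

/-- The complete homogeneous symmetric function of degree `m` in the `x i`, `i ∈ s`. -/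
def complHom (s : Finset ι) (x : ι → K) : ℤ → K
  | Int.ofNat m => PowerSeries.coeff m (∏ i ∈ s, PowerSeries.mk fun n => x i ^ n)
  | Int.negSucc _ => 0

lemma complHom_of_neg (s : Finset ι) (x : ι → K) {m : ℤ} (hm : m < 0) : complHom s x m = 0 := by
  obtain ⟨k, rfl⟩ := Int.eq_negSucc_of_lt_zero hm
  rfl

lemma complHom_zero (s : Finset ι) (x : ι → K) : complHom s x 0 = 1 := by
  change PowerSeries.coeff 0 _ = _
  simp [map_prod]

lemma geom_mul_one_sub (a : K) :
    (PowerSeries.mk fun n => a ^ n) * (1 - PowerSeries.C a * PowerSeries.X) = 1 := by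
  ext n
  rw [mul_sub, mul_one, ← mul_assoc, mul_comm _ (PowerSeries.C a), mul_assoc, map_sub,
    PowerSeries.coeff_C_mul]
  cases n with
  | zero => simp
  | succ n => simp [PowerSeries.coeff_succ_mul_X, pow_succ', PowerSeries.coeff_one]

/-- Multiplying the generating function of `insert a s` by `1 - x a * X` removes its geometric
factor at `a`; coefficients are then compared. -/
lemma complHom_insert [DecidableEq ι] (s : Finset ι) (x : ι → K) {a : ι} (ha : a ∉ s) (m : ℤ) :
    complHom (insert a s) x m = x a * complHom (insert a s) x (m - 1) + complHom s x m := by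
  rcases lt_trichotomy m 0 with hm | rfl | hm
  · rw [complHom_of_neg _ _ hm, complHom_of_neg _ _ hm, complHom_of_neg _ _ (by omega)]
    simp
  · rw [complHom_zero, complHom_zero, complHom_of_neg _ _ (by omega)]
    simp
  · obtain ⟨k, rfl⟩ : ∃ k : ℕ, m = ((k + 1 : ℕ) : ℤ) := ⟨(m - 1).toNat, by omega⟩
    rw [show ((k + 1 : ℕ) : ℤ) - 1 = (k : ℤ) by push_cast; ring]
    change PowerSeries.coeff (k + 1) _ =
      x a * PowerSeries.coeff k _ + PowerSeries.coeff (k + 1) _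
    rw [Finset.prod_insert ha]
    set P := ∏ i ∈ s, PowerSeries.mk fun n => x i ^ n
    have h : P = (PowerSeries.mk fun n => x a ^ n) * P -
        PowerSeries.C (x a) * (((PowerSeries.mk fun n => x a ^ n) * P) * PowerSeries.X) := by
      linear_combination (-P) * geom_mul_one_sub (x a)
    have h' := congrArg (PowerSeries.coeff (k + 1)) h
    rw [map_sub, PowerSeries.coeff_C_mul, PowerSeries.coeff_succ_mul_X] at h'
    linear_combination -h'

/-- Writing `x i ^ (N + 1) = x a * x i ^ N + x i ^ N * (x i - x a)` splits the sum just as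
`complHom_insert` splits the right side, so a double induction on the set and on `N` applies. -/
lemma sum_pow_div_prod_sub [DecidableEq ι] (s : Finset ι) (x : ι → K) (hx : Set.InjOn x s) (N : ℕ) :
    ∑ i ∈ s, x i ^ N / ∏ j ∈ s.erase i, (x i - x j) =
      complHom s x ((N : ℤ) + 1 - s.card) := by
  induction s using Finset.induction_on generalizing N with
  | empty =>
    rw [show ((N : ℤ) + 1 - (∅ : Finset ι).card) = ((N + 1 : ℕ) : ℤ) by simp]
    change _ = PowerSeries.coeff (N + 1) _
    simp [PowerSeries.coeff_one]
  | insert a s ha ih =>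
    have hxs : Set.InjOn x s := hx.mono (by simp)
    have hcard : (insert a s).card = s.card + 1 := Finset.card_insert_of_notMem ha
    induction N with
    | zero =>
      -- For `N = 0` the sum is the coefficient of degree `s.card` in the interpolant of the
      -- constant `1`: it is `1` for a single node and `0` for more.
      have h := Lagrange.coeff_eq_sum hx (P := (1 : Polynomial K)) (by
        rw [Polynomial.degree_one, hcard]
        exact_mod_cast Nat.succ_pos _)
      simp only [Polynomial.eval_one] at h
      simp only [pow_zero]
      rw [← h, hcard, Nat.add_sub_cancel, Polynomial.coeff_one]
      split_ifs with h0
      · rw [h0]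
        exact (complHom_zero _ _).symm
      · rw [complHom_of_neg _ _ (by push_cast; omega)]
    | succ N ihN =>
      rw [complHom_insert _ _ ha]
      have e1 : ((N + 1 : ℕ) : ℤ) + 1 - ((insert a s).card : ℤ) - 1 =
        (N : ℤ) + 1 - (insert a s).card := by push_cast; ring
      have e2 : ((N + 1 : ℕ) : ℤ) + 1 - ((insert a s).card : ℤ) = (N : ℤ) + 1 - s.card := by
        rw [hcard]; push_cast; ring
      rw [e1, e2, ← ihN, ← ih hxs, Finset.sum_insert ha, Finset.sum_insert ha, mul_add,
        Finset.mul_sum, pow_succ', mul_div_assoc, add_assoc, ← Finset.sum_add_distrib]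
      congr 1
      refine Finset.sum_congr rfl fun i hi => ?_
      have hia : a ≠ i := fun h => ha (h ▸ hi)
      have hne : x i - x a ≠ 0 := sub_ne_zero.2 fun h =>
        hia (hx (by simp) (by simp [hi]) h.symm)
      rw [Finset.erase_insert_of_ne hia, Finset.prod_insert (by simp [ha])]
      have hP : ∏ j ∈ s.erase i, (x i - x j) ≠ 0 := Finset.prod_ne_zero_iff.2 fun j hj =>
        sub_ne_zero.2 fun h => (Finset.mem_erase.1 hj).1
          (hxs (Finset.mem_erase.1 hj).2 hi h.symm)
      field_simp
      ring

lemma prod_sub_eq_sum_esymm (t : Finset ι) (x : ι → K) (z : K) :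
    ∏ d ∈ t, (z - x d) = ∑ j ∈ Finset.range (t.card + 1),
      (-1) ^ j * (t.val.map x).esymm j * z ^ (t.card - j) := by
  have h := congrArg (Polynomial.eval z) (Multiset.prod_X_sub_X_eq_sum_esymm (t.val.map x))
  rw [Multiset.map_map] at h
  change Polynomial.eval z (∏ d ∈ t, (Polynomial.X - Polynomial.C (x d))) = _ at h
  rw [Polynomial.eval_prod] at h
  simp only [Polynomial.eval_sub, Polynomial.eval_X, Polynomial.eval_C, Polynomial.eval_finsetSum,
    Polynomial.eval_mul, Polynomial.eval_pow, Polynomial.eval_neg, Polynomial.eval_one,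
    Multiset.card_map, Finset.card_val] at h
  rw [h]
  refine Finset.sum_congr rfl fun j _ => by ring

lemma sum_pow_mul_prod_div_prod [DecidableEq ι] (s t : Finset ι) (x : ι → K) (hx : Set.InjOn x s) (N : ℕ) :
    ∑ i ∈ s, x i ^ N * ((∏ d ∈ t, (x i - x d)) / ∏ j ∈ s.erase i, (x i - x j)) =
      ∑ j ∈ Finset.range (t.card + 1), (-1) ^ j * (t.val.map x).esymm j *
        complHom s x ((N : ℤ) + 1 - j - (s.card - t.card)) := by
  simp only [prod_sub_eq_sum_esymm t x, Finset.sum_div, Finset.mul_sum]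
  rw [Finset.sum_comm]
  refine Finset.sum_congr rfl fun j hj => ?_
  have hj' : j ≤ t.card := Nat.lt_succ_iff.1 (Finset.mem_range.1 hj)
  rw [show (N : ℤ) + 1 - j - (s.card - t.card) = ((N + (t.card - j) : ℕ) : ℤ) + 1 - s.card by
    push_cast [hj']; ring, ← sum_pow_div_prod_sub s x hx, Finset.mul_sum]
  refine Finset.sum_congr rfl fun i _ => ?_
  rw [pow_add]
  ring

/-- The polynomial `∏ (X - x d)` has degree less than the number of nodes `x i`, so it is its own
Lagrange interpolant; evaluate at `z` and divide by the nodal polynomial. -/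
lemma sum_inv_sub_mul_prod_div_prod [DecidableEq ι] (s t : Finset ι) (x : ι → K) (hx : Set.InjOn x s)
    (hts : t.card < s.card) (z : K) (hz : ∀ i ∈ s, z ≠ x i) :
    ∑ i ∈ s, (z - x i)⁻¹ * ((∏ d ∈ t, (x i - x d)) / ∏ j ∈ s.erase i, (x i - x j)) =
      (∏ d ∈ t, (z - x d)) / ∏ i ∈ s, (z - x i) := by
  have hdeg : (Lagrange.nodal t x).degree < s.card := by
    rw [Lagrange.degree_nodal]
    exact_mod_cast hts
  have h := congrArg (Polynomial.eval z) (Lagrange.eq_interpolate hx hdeg)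
  rw [Lagrange.eval_interpolate_not_at_node _ hz] at h
  simp only [Lagrange.eval_nodal] at h
  have hP : ∏ i ∈ s, (z - x i) ≠ 0 :=
    Finset.prod_ne_zero_iff.2 fun i hi => sub_ne_zero.2 (hz i hi)
  rw [h, mul_div_cancel_left₀ _ hP]
  refine Finset.sum_congr rfl fun i _ => ?_
  rw [Lagrange.nodalWeight, Finset.prod_inv_distrib]
  ring

end SymmetricFunctions

/-- The coefficient of a product of geometric series is a sum over exponent vectors on `A`, which
correspond to multisets of size `m`. -/
lemma homSymm_eq_complHom {r : ℕ} (A : Finset (Box r)) (m : ℤ) :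
    homSymm A m = complHom A ct m := by
  cases m with
  | negSucc m => rfl
  | ofNat m =>
    change MvPolynomial.aeval _ _ = PowerSeries.coeff m _
    rw [PowerSeries.coeff_prod, MvPolynomial.hsymm, map_sum, ← Finset.sum_coe_sort (A.finsuppAntidiag m),
      ← (Finset.finsuppAntidiagEquiv A m).sum_comp]
    refine Finset.sum_congr rfl fun l _ => ?_
    rw [map_multiset_prod, Multiset.map_map]
    simp only [PowerSeries.coeff_mk, Function.comp_def, MvPolynomial.aeval_X]
    rw [Finset.prod_multiset_map_count, ← Finset.prod_coe_sort A,
      Finset.prod_subset (Finset.subset_univ _)]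
    · refine Finset.prod_congr rfl fun a _ => ?_
      rw [← Finset.count_coe_finsuppAntidiagEquiv_apply]
      rfl
    · intro a _ ha
      rw [Multiset.count_eq_zero_of_notMem (by simpa using ha), pow_zero]

lemma elemSymm_eq_esymm {r : ℕ} (A : Finset (Box r)) (t : ℕ) :
    elemSymm A t = (A.val.map ct).esymm t := by
  rw [elemSymm, MvPolynomial.aeval_esymm_eq_multiset_esymm]
  congr 1
  exact Multiset.attach_map_val' A.val ct

/-! ### Convex sets of boxes and their corners. -/

variable {r : ℕ}

/-- The position directly to the right. -/
def Box.right (b : Box r) : Box r := (b.1, b.2.1, b.2.2 + 1)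

/-- The position directly below. -/
def Box.down (b : Box r) : Box r := (b.1, b.2.1 + 1, b.2.2)

/-- The position directly southeast. -/
def Box.diag (b : Box r) : Box r := (b.1, b.2.1 + 1, b.2.2 + 1)

lemma Box.right_injective : Function.Injective (Box.right (r := r)) := by
  rintro ⟨m, i, j⟩ ⟨m', i', j'⟩ h
  simpa [Box.right] using h

lemma Box.down_injective : Function.Injective (Box.down (r := r)) := by
  rintro ⟨m, i, j⟩ ⟨m', i', j'⟩ h
  simpa [Box.down] using h

lemma Box.diag_injective : Function.Injective (Box.diag (r := r)) := by
  rintro ⟨m, i, j⟩ ⟨m', i', j'⟩ h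
  simpa [Box.diag] using h

/-- A set of boxes which contains, with two boxes of a diagram, the rectangle between them. -/
def IsConvex (A : Finset (Box r)) : Prop :=
  ∀ (m : Fin r) (i j i' j' i'' j'' : ℕ), (m, i, j) ∈ A → (m, i'', j'') ∈ A →
    i ≤ i' → i' ≤ i'' → j ≤ j' → j' ≤ j'' → (m, i', j') ∈ A

/-- The boxes of `A` with no box above and no box to the left. -/
def sharp (A : Finset (Box r)) : Finset (Box r) :=
  A.filter fun b => b ∉ A.image Box.down ∧ b ∉ A.image Box.right

/-- The boxes of `A` with a box above and a box to the left, but no box northwest. -/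
def dull (A : Finset (Box r)) : Finset (Box r) :=
  A.filter fun b => b ∈ A.image Box.down ∧ b ∈ A.image Box.right ∧ b ∉ A.image Box.diag

/-- `-1` at sharp corners, `1` at dull corners, and `0` at the other boxes. -/
def cornerExp (A : Finset (Box r)) (b : Box r) : ℤ :=
  -1 + (if b ∈ A.image Box.right then 1 else 0) + (if b ∈ A.image Box.down then 1 else 0) -
    (if b ∈ A.image Box.diag then 1 else 0)

lemma mem_image_right {A : Finset (Box r)} {m : Fin r} {i j : ℕ} :
    (m, i, j) ∈ A.image Box.right ↔ ∃ k, k + 1 = j ∧ (m, i, k) ∈ A := by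
  simp only [Finset.mem_image, Box.right, Prod.mk.injEq]
  constructor
  · rintro ⟨⟨m', i', j'⟩, h, rfl, rfl, rfl⟩
    exact ⟨j', rfl, h⟩
  · rintro ⟨k, rfl, h⟩
    exact ⟨_, h, rfl, rfl, rfl⟩

lemma mem_image_down {A : Finset (Box r)} {m : Fin r} {i j : ℕ} :
    (m, i, j) ∈ A.image Box.down ↔ ∃ k, k + 1 = i ∧ (m, k, j) ∈ A := by
  simp only [Finset.mem_image, Box.down, Prod.mk.injEq]
  constructor
  · rintro ⟨⟨m', i', j'⟩, h, rfl, rfl, rfl⟩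
    exact ⟨i', rfl, h⟩
  · rintro ⟨k, rfl, h⟩
    exact ⟨_, h, rfl, rfl, rfl⟩

lemma mem_image_diag {A : Finset (Box r)} {m : Fin r} {i j : ℕ} :
    (m, i, j) ∈ A.image Box.diag ↔ ∃ k l, k + 1 = i ∧ l + 1 = j ∧ (m, k, l) ∈ A := by
  simp only [Finset.mem_image, Box.diag, Prod.mk.injEq]
  constructor
  · rintro ⟨⟨m', i', j'⟩, h, rfl, rfl, rfl⟩
    exact ⟨i', j', rfl, rfl, h⟩
  · rintro ⟨k, l, rfl, rfl, h⟩
    exact ⟨_, h, rfl, rfl, rfl⟩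

lemma IsConvex.mem_image_of_diag {A : Finset (Box r)} (hA : IsConvex A) {b : Box r} (hb : b ∈ A)
    (h : b ∈ A.image Box.diag) : b ∈ A.image Box.right ∧ b ∈ A.image Box.down := by
  obtain ⟨m, i, j⟩ := b
  obtain ⟨k, l, rfl, rfl, h'⟩ := mem_image_diag.1 h
  exact ⟨mem_image_right.2 ⟨l, rfl, hA m k l _ _ _ _ h' hb (by omega) (by omega) le_rfl (by omega)⟩,
    mem_image_down.2 ⟨k, rfl, hA m k l _ _ _ _ h' hb le_rfl (by omega) (by omega) (by omega)⟩⟩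

/-- By convexity a box to the northwest forces boxes to the left and above, so only the values `-1`,
`0`, `1` occur. The form with indicators is the one that is easy to follow when a box is deleted. -/
lemma IsConvex.cornerExp_eq {A : Finset (Box r)} (hA : IsConvex A) {b : Box r} (hb : b ∈ A) :
    cornerExp A b = (if b ∈ dull A then 1 else 0) - (if b ∈ sharp A then 1 else 0) := by
  have h := hA.mem_image_of_diag hb
  simp only [cornerExp, dull, sharp, Finset.mem_filter, hb, true_and]
  by_cases h3 : b ∈ A.image Box.diag
  · simp [h3, h h3, -Finset.mem_image]
  · by_cases h1 : b ∈ A.image Box.right <;> by_cases h2 : b ∈ A.image Box.down <;>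
      simp [h1, h2, h3, -Finset.mem_image]

/-- A sharp corner is minimal among the boxes. -/
lemma IsConvex.eq_of_le_sharp {A : Finset (Box r)} (hA : IsConvex A) {m : Fin r} {i j i' j' : ℕ}
    (hs : (m, i, j) ∈ sharp A) (hb : (m, i', j') ∈ A) (hi : i' ≤ i) (hj : j' ≤ j) :
    i' = i ∧ j' = j := by
  simp only [sharp, Finset.mem_filter, mem_image_down, mem_image_right, not_exists, not_and] at hs
  obtain ⟨hs, h1, h2⟩ := hs
  constructor
  · by_contra h
    exact h1 (i - 1) (by omega)
      (hA m i' j' (i - 1) j i j hb hs (by omega) (by omega) hj le_rfl)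
  · by_contra h
    exact h2 (j - 1) (by omega)
      (hA m i' j' i (j - 1) i j hb hs hi le_rfl (by omega) (by omega))

lemma IsConvex.erase_sharp {A : Finset (Box r)} (hA : IsConvex A) {s : Box r}
    (hs : s ∈ sharp A) : IsConvex (A.erase s) := by
  obtain ⟨m₀, i₀, j₀⟩ := s
  intro m i j i' j' i'' j'' h h'' h1 h2 h3 h4
  rw [Finset.mem_erase] at *
  refine ⟨fun he => h.1 ?_, hA m i j i' j' i'' j'' h.2 h''.2 h1 h2 h3 h4⟩
  obtain ⟨rfl, rfl, rfl⟩ : m = m₀ ∧ i' = i₀ ∧ j' = j₀ := by simpa using he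
  obtain ⟨rfl, rfl⟩ := hA.eq_of_le_sharp hs h.2 h1 h3
  rfl

/-! ### Edge weights and the removal of a sharp corner. -/

section Weights

variable {K : Type*} [Field K]

/-- The values separate the diagonals of the diagrams. -/
def SeparatesDiagonals (x : Box r → K) : Prop :=
  ∀ a b : Box r, x a = x b ↔ a.1 = b.1 ∧ a.2.2 + b.2.1 = b.2.2 + a.2.1

/-- The contribution of the edges from a box to the right and down; a `2 × 2` block
contributes `0`. -/
def edgeFactor (x : Box r → K) (A : Finset (Box r)) (b : Box r) : K :=
  (if b.right ∈ A then (x b - x b.right)⁻¹ else 1) *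
    (if b.down ∈ A then (x b - x b.down)⁻¹ else 1) * (if b.diag ∈ A then 0 else 1)

/-- The product of the contributions of all edges. -/
def edgeProd (x : Box r → K) (A : Finset (Box r)) : K := ∏ b ∈ A, edgeFactor x A b

lemma mem_image_right_erase {A : Finset (Box r)} {s b : Box r} :
    b ∈ (A.erase s).image Box.right ↔ b ∈ A.image Box.right ∧ b ≠ s.right := by
  simp only [Finset.mem_image, Finset.mem_erase]
  constructor
  · rintro ⟨a, ⟨h1, h2⟩, rfl⟩
    exact ⟨⟨a, h2, rfl⟩, fun h => h1 (Box.right_injective h)⟩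
  · rintro ⟨⟨a, h, rfl⟩, h2⟩
    exact ⟨a, ⟨fun h => h2 (h ▸ rfl), h⟩, rfl⟩

lemma mem_image_down_erase {A : Finset (Box r)} {s b : Box r} :
    b ∈ (A.erase s).image Box.down ↔ b ∈ A.image Box.down ∧ b ≠ s.down := by
  simp only [Finset.mem_image, Finset.mem_erase]
  constructor
  · rintro ⟨a, ⟨h1, h2⟩, rfl⟩
    exact ⟨⟨a, h2, rfl⟩, fun h => h1 (Box.down_injective h)⟩
  · rintro ⟨⟨a, h, rfl⟩, h2⟩
    exact ⟨a, ⟨fun h => h2 (h ▸ rfl), h⟩, rfl⟩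

lemma mem_image_diag_erase {A : Finset (Box r)} {s b : Box r} :
    b ∈ (A.erase s).image Box.diag ↔ b ∈ A.image Box.diag ∧ b ≠ s.diag := by
  simp only [Finset.mem_image, Finset.mem_erase]
  constructor
  · rintro ⟨a, ⟨h1, h2⟩, rfl⟩
    exact ⟨⟨a, h2, rfl⟩, fun h => h1 (Box.diag_injective h)⟩
  · rintro ⟨⟨a, h, rfl⟩, h2⟩
    exact ⟨a, ⟨fun h => h2 (h ▸ rfl), h⟩, rfl⟩

lemma ite_and_not_eq_sub {P Q : Prop} [Decidable P] [Decidable Q] [Decidable (Q ∧ ¬ P)]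
    (h : P → Q) : (if Q ∧ ¬ P then (1 : ℤ) else 0) = (if Q then 1 else 0) - (if P then 1 else 0) := by
  split_ifs <;> simp_all

lemma cornerExp_erase {A : Finset (Box r)} {s : Box r} (hs : s ∈ A) (b : Box r) :
    cornerExp (A.erase s) b = cornerExp A b - (if b = s.right then 1 else 0) -
      (if b = s.down then 1 else 0) + (if b = s.diag then 1 else 0) := by
  have h1 : b = s.right → b ∈ A.image Box.right := fun h =>
    h ▸ Finset.mem_image_of_mem _ hs
  have h2 : b = s.down → b ∈ A.image Box.down := fun h =>
    h ▸ Finset.mem_image_of_mem _ hs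
  have h3 : b = s.diag → b ∈ A.image Box.diag := fun h =>
    h ▸ Finset.mem_image_of_mem _ hs
  simp only [cornerExp, mem_image_right_erase, mem_image_down_erase, mem_image_diag_erase]
  rw [ite_and_not_eq_sub h1, ite_and_not_eq_sub h2, ite_and_not_eq_sub h3]
  ring

/-- No edge and no block has a sharp corner as its lower or right end, so the factors of the other
boxes do not notice the removal. -/
lemma IsConvex.edgeProd_erase {A : Finset (Box r)} (hA : IsConvex A) (x : Box r → K)
    {s : Box r} (hs : s ∈ sharp A) :
    edgeProd x A = edgeFactor x A s * edgeProd x (A.erase s) := by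
  have hs' := hs
  simp only [sharp, Finset.mem_filter] at hs'
  obtain ⟨hsA, hd, hr⟩ := hs'
  rw [edgeProd, ← Finset.mul_prod_erase _ _ hsA, edgeProd]
  congr 1
  refine Finset.prod_congr rfl fun b hb => ?_
  have hbA := (Finset.mem_erase.1 hb).2
  have h1 : b.right ≠ s := fun h => hr (h ▸ Finset.mem_image_of_mem _ hbA)
  have h2 : b.down ≠ s := fun h => hd (h ▸ Finset.mem_image_of_mem _ hbA)
  have h3 : b.diag ≠ s := by
    intro h
    exact hr (hA.mem_image_of_diag hsA (h ▸ Finset.mem_image_of_mem _ hbA)).1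
  simp [edgeFactor, Finset.mem_erase, h1, h2, h3]

/-- Removal of a sharp corner. -/
lemma IsConvex.edgeProd_mul_prod_erase {A : Finset (Box r)} (hA : IsConvex A) {x : Box r → K}
    (hx : SeparatesDiagonals x) {s : Box r} (hs : s ∈ sharp A) :
    edgeProd x (A.erase s) * ∏ b ∈ A.erase s, (x s - x b) ^ cornerExp (A.erase s) b =
      edgeProd x A * ∏ b ∈ A.erase s, (x s - x b) ^ cornerExp A b := by
  have hsA : s ∈ A := (Finset.mem_filter.1 hs).1
  have hdr : s.right ≠ s.down := by simp [Box.right, Box.down]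
  have hxr : x s - x s.right ≠ 0 := sub_ne_zero.2 fun h => by
    have := ((hx _ _).1 h).2
    simp [Box.right] at this
  have hxd : x s - x s.down ≠ 0 := sub_ne_zero.2 fun h => by
    have := ((hx _ _).1 h).2
    simp [Box.down] at this
  rw [hA.edgeProd_erase x hs]
  -- If `s` is the northwest box of a block, both sides vanish: the right one by `edgeFactor`, the
  -- left one because `s.diag` becomes a dull corner with the same value as `s`. Otherwise the
  -- exponents drop by one exactly at the right and lower neighbours of `s`, which restores the edge
  -- factors of `s`.
  by_cases hdiag : s.diag ∈ A
  · have hne : s.diag ≠ s := by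
      obtain ⟨m, i, j⟩ := s
      simp [Box.diag]
    have hmem : s.diag ∈ A.erase s := Finset.mem_erase.2 ⟨hne, hdiag⟩
    have hr : s.diag ∈ A.image Box.right := by
      have := (hA.mem_image_of_diag hdiag (Finset.mem_image_of_mem _ hsA)).1
      exact this
    have hd : s.diag ∈ A.image Box.down :=
      (hA.mem_image_of_diag hdiag (Finset.mem_image_of_mem _ hsA)).2
    have hexp : cornerExp (A.erase s) s.diag = 1 := by
      rw [cornerExp_erase hsA, cornerExp, if_pos hr, if_pos hd,
        if_pos (Finset.mem_image_of_mem _ hsA)]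
      obtain ⟨m, i, j⟩ := s
      simp [Box.diag, Box.right, Box.down]
    have hxx : x s - x s.diag = 0 := sub_eq_zero.2 <| (hx _ _).2 ⟨rfl, by
      simp [Box.diag]; omega⟩
    rw [Finset.prod_eq_zero hmem (by rw [hexp, hxx, zpow_one])]
    simp [edgeFactor, hdiag]
  · have key : ∀ b ∈ A.erase s, (x s - x b) ^ cornerExp (A.erase s) b =
        (x s - x b) ^ cornerExp A b * (if b = s.right then (x s - x b)⁻¹ else 1) *
          (if b = s.down then (x s - x b)⁻¹ else 1) := by
      intro b hb
      rw [cornerExp_erase hsA, if_neg (fun h : b = s.diag => hdiag (h ▸ (Finset.mem_erase.1 hb).2))]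
      by_cases h1 : b = s.right
      · subst h1
        rw [if_pos rfl, if_pos rfl, if_neg hdr, if_neg hdr, sub_zero, add_zero, mul_one,
          zpow_sub_one₀ hxr]
      · by_cases h2 : b = s.down
        · subst h2
          rw [if_pos rfl, if_pos rfl, if_neg h1, if_neg h1, sub_zero, add_zero, mul_one,
            zpow_sub_one₀ hxd]
        · simp [h1, h2]
    have hmr : s.right ∈ A.erase s ↔ s.right ∈ A := by
      rw [Finset.mem_erase, and_iff_right]
      obtain ⟨m, i, j⟩ := s
      simp [Box.right]
    have hmd : s.down ∈ A.erase s ↔ s.down ∈ A := by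
      rw [Finset.mem_erase, and_iff_right]
      obtain ⟨m, i, j⟩ := s
      simp [Box.down]
    rw [Finset.prod_congr rfl key, Finset.prod_mul_distrib, Finset.prod_mul_distrib,
      Finset.prod_ite_eq', Finset.prod_ite_eq']
    simp only [hmr, hmd, edgeFactor, if_neg hdiag]
    ring

lemma IsConvex.prod_zpow_cornerExp {A B : Finset (Box r)} (hA : IsConvex A) (hB : B ⊆ A)
    (y : Box r → K) :
    ∏ b ∈ B, y b ^ cornerExp A b = (∏ d ∈ dull A ∩ B, y d) / ∏ s ∈ sharp A ∩ B, y s := by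
  rw [Finset.inter_comm (dull A), Finset.inter_comm (sharp A), ← Finset.prod_ite_mem,
    ← Finset.prod_ite_mem, ← Finset.prod_div_distrib]
  refine Finset.prod_congr rfl fun b hb => ?_
  rw [hA.cornerExp_eq (hB hb)]
  have hdisj : b ∈ dull A → b ∉ sharp A := by
    simp only [dull, sharp, Finset.mem_filter]
    tauto
  by_cases h1 : b ∈ dull A <;> by_cases h2 : b ∈ sharp A <;> simp_all

end Weights

/-! ### Counting corners by rows. -/

/-- The diagram and the row of a position. -/
def Box.rowIndex (b : Box r) : Fin r × ℕ := (b.1, b.2.1)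

/-- The diagram and the column of a position. -/
def Box.colIndex (b : Box r) : Fin r × ℕ := (b.1, b.2.2)

/-- The rows which contain a box that lies below another box. -/
def joinedRows (A : Finset (Box r)) : Finset (Fin r × ℕ) :=
  (A.filter fun b => b ∈ A.image Box.down).image Box.rowIndex

lemma mem_joinedRows {A : Finset (Box r)} {m : Fin r} {i : ℕ} :
    (m, i) ∈ joinedRows A ↔ ∃ k j, k + 1 = i ∧ (m, i, j) ∈ A ∧ (m, k, j) ∈ A := by
  constructor
  · intro h
    obtain ⟨⟨m', i', j⟩, hb, he⟩ := Finset.mem_image.1 h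
    obtain ⟨rfl, rfl⟩ : m' = m ∧ i' = i := by simpa [Box.rowIndex] using he
    obtain ⟨h1, h2⟩ := Finset.mem_filter.1 hb
    obtain ⟨k, hk, h3⟩ := mem_image_down.1 h2
    exact ⟨k, j, hk, h1, h3⟩
  · rintro ⟨k, j, rfl, h1, h2⟩
    exact Finset.mem_image.2 ⟨(m, k + 1, j),
      Finset.mem_filter.2 ⟨h1, mem_image_down.2 ⟨k, rfl, h2⟩⟩, rfl⟩

lemma mem_image_rowIndex {A : Finset (Box r)} {m : Fin r} {i : ℕ} :
    (m, i) ∈ A.image Box.rowIndex ↔ ∃ j, (m, i, j) ∈ A := by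
  simp [Box.rowIndex]

lemma joinedRows_subset (A : Finset (Box r)) : joinedRows A ⊆ A.image Box.rowIndex :=
  Finset.image_subset_image (Finset.filter_subset _ _)

/-- A row of least index among all boxes has nothing above it. -/
lemma card_joinedRows_lt {A : Finset (Box r)} (hA : A.Nonempty) :
    (joinedRows A).card < (A.image Box.rowIndex).card := by
  refine Finset.card_lt_card ((Finset.ssubset_iff_of_subset (joinedRows_subset A)).2 ?_)
  obtain ⟨⟨m, i, j⟩, hb, hmin⟩ := A.exists_min_image (fun b => b.2.1) hA
  refine ⟨(m, i), mem_image_rowIndex.2 ⟨j, hb⟩, fun h => ?_⟩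
  obtain ⟨k, l, hk, -, h2⟩ := mem_joinedRows.1 h
  have := hmin _ h2
  simp only at this
  omega

/-- By convexity each row of a diagram is an interval, which has exactly one leftmost box. -/
lemma IsConvex.card_filter_notMem_right {A : Finset (Box r)} (hA : IsConvex A) :
    (A.filter fun b => b ∉ A.image Box.right).card = (A.image Box.rowIndex).card := by
  refine Finset.card_nbij Box.rowIndex
    (fun b hb => Finset.mem_image_of_mem _ (Finset.mem_filter.1 hb).1) ?_ ?_
  · have aux : ∀ (m : Fin r) (i j j' : ℕ), (m, i, j) ∈ A → (m, i, j') ∈ A →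
        (m, i, j') ∉ A.image Box.right → ¬ j < j' := by
      intro m i j j' h h' hr hlt
      exact hr (mem_image_right.2 ⟨j' - 1, by omega,
        hA m i j i (j' - 1) i j' h h' le_rfl le_rfl (by omega) (by omega)⟩)
    rintro ⟨m, i, j⟩ hb ⟨m', i', j'⟩ hb' he
    obtain ⟨rfl, rfl⟩ : m = m' ∧ i = i' := by simpa [Box.rowIndex] using he
    have hb := Finset.mem_filter.1 (Finset.mem_coe.1 hb)
    have hb' := Finset.mem_filter.1 (Finset.mem_coe.1 hb')
    have h1 := aux _ _ _ _ hb.1 hb'.1 hb'.2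
    have h2 := aux _ _ _ _ hb'.1 hb.1 hb.2
    obtain rfl : j = j' := by omega
    rfl
  · rintro ⟨m, i⟩ hmi
    have hex := mem_image_rowIndex.1 (Finset.mem_coe.1 hmi)
    classical
    refine ⟨(m, i, Nat.find hex), Finset.mem_coe.2 (Finset.mem_filter.2
      ⟨Nat.find_spec hex, fun h => ?_⟩), rfl⟩
    obtain ⟨k, hk, h⟩ := mem_image_right.1 h
    exact Nat.find_min hex (by omega) h

lemma IsConvex.card_filter_notMem_down {A : Finset (Box r)} (hA : IsConvex A) :
    (A.filter fun b => b ∉ A.image Box.down).card = (A.image Box.colIndex).card := by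
  refine Finset.card_nbij Box.colIndex
    (fun b hb => Finset.mem_image_of_mem _ (Finset.mem_filter.1 hb).1) ?_ ?_
  · have aux : ∀ (m : Fin r) (i i' j : ℕ), (m, i, j) ∈ A → (m, i', j) ∈ A →
        (m, i', j) ∉ A.image Box.down → ¬ i < i' := by
      intro m i i' j h h' hr hlt
      exact hr (mem_image_down.2 ⟨i' - 1, by omega,
        hA m i j (i' - 1) j i' j h h' (by omega) (by omega) le_rfl le_rfl⟩)
    rintro ⟨m, i, j⟩ hb ⟨m', i', j'⟩ hb' he
    obtain ⟨rfl, rfl⟩ : m = m' ∧ j = j' := by simpa [Box.colIndex] using he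
    have hb := Finset.mem_filter.1 (Finset.mem_coe.1 hb)
    have hb' := Finset.mem_filter.1 (Finset.mem_coe.1 hb')
    have h1 := aux _ _ _ _ hb.1 hb'.1 hb'.2
    have h2 := aux _ _ _ _ hb'.1 hb.1 hb.2
    obtain rfl : i = i' := by omega
    rfl
  · rintro ⟨m, j⟩ hmj
    have hex : ∃ i, (m, i, j) ∈ A := by simpa [Box.colIndex] using hmj
    classical
    refine ⟨(m, Nat.find hex, j), Finset.mem_coe.2 (Finset.mem_filter.2
      ⟨Nat.find_spec hex, fun h => ?_⟩), rfl⟩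
    obtain ⟨k, hk, h⟩ := mem_image_down.1 h
    exact Nat.find_min hex (by omega) h

/-- In a joined row the boxes with a box above form an interval; the condition singles out its
leftmost box. -/
lemma IsConvex.card_dull_add {A : Finset (Box r)} (hA : IsConvex A) :
    (A.filter fun b => b ∈ A.image Box.down ∧
      (b ∉ A.image Box.right ∨ b ∉ A.image Box.diag)).card = (joinedRows A).card := by
  refine Finset.card_nbij Box.rowIndex (fun b hb => Finset.mem_image_of_mem _ ?_) ?_ ?_
  · exact Finset.mem_filter.2
      ⟨(Finset.mem_filter.1 hb).1, (Finset.mem_filter.1 hb).2.1⟩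
  · have aux : ∀ (m : Fin r) (i j j' : ℕ), (m, i, j) ∈ A → (m, i, j') ∈ A →
        (m, i, j) ∈ A.image Box.down → (m, i, j') ∈ A.image Box.down →
        ((m, i, j') ∉ A.image Box.right ∨ (m, i, j') ∉ A.image Box.diag) → ¬ j < j' := by
      intro m i j j' h h' hd hd' hr hlt
      obtain ⟨k, rfl, ha⟩ := mem_image_down.1 hd
      obtain ⟨k', hk, ha'⟩ := mem_image_down.1 hd'
      obtain rfl : k' = k := by omega
      rcases hr with hr | hr
      · exact hr (mem_image_right.2 ⟨j' - 1, by omega,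
          hA m _ j _ (j' - 1) _ j' h h' le_rfl le_rfl (by omega) (by omega)⟩)
      · exact hr (mem_image_diag.2 ⟨k', j' - 1, rfl, by omega,
          hA m _ j _ (j' - 1) _ j' ha ha' le_rfl le_rfl (by omega) (by omega)⟩)
    rintro ⟨m, i, j⟩ hb ⟨m', i', j'⟩ hb' he
    obtain ⟨rfl, rfl⟩ : m = m' ∧ i = i' := by simpa [Box.rowIndex] using he
    have hb := Finset.mem_filter.1 (Finset.mem_coe.1 hb)
    have hb' := Finset.mem_filter.1 (Finset.mem_coe.1 hb')
    have h1 := aux _ _ _ _ hb.1 hb'.1 hb.2.1 hb'.2.1 hb'.2.2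
    have h2 := aux _ _ _ _ hb'.1 hb.1 hb'.2.1 hb.2.1 hb.2.2
    obtain rfl : j = j' := by omega
    rfl
  · rintro ⟨m, i⟩ hmi
    obtain ⟨k, j, rfl, h1, h2⟩ := mem_joinedRows.1 (Finset.mem_coe.1 hmi)
    have hex : ∃ j, (m, k + 1, j) ∈ A ∧ (m, k, j) ∈ A := ⟨j, h1, h2⟩
    classical
    refine ⟨(m, k + 1, Nat.find hex), Finset.mem_coe.2 (Finset.mem_filter.2
      ⟨(Nat.find_spec hex).1, mem_image_down.2 ⟨k, rfl, (Nat.find_spec hex).2⟩, ?_⟩), rfl⟩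
    by_contra! hcon
    obtain ⟨l, hl, h3⟩ := mem_image_right.1 hcon.1
    obtain ⟨k', l', hk, hl', h4⟩ := mem_image_diag.1 hcon.2
    obtain rfl : k' = k := by omega
    obtain rfl : l' = l := by omega
    exact Nat.find_min hex (by omega) ⟨h3, h4⟩

/-- There are as many sharp corners as dull corners and rows that are not joined to the row
above. -/
lemma IsConvex.card_sharp_add {A : Finset (Box r)} (hA : IsConvex A) :
    (sharp A).card + (joinedRows A).card = (dull A).card + (A.image Box.rowIndex).card := by
  rw [← hA.card_dull_add, ← hA.card_filter_notMem_right, sharp, dull]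
  -- The leftmost boxes of rows are the sharp corners and those with a box above. The latter,
  -- together with the dull corners, make up the set counted by `joinedRows`, so they cancel.
  rw [← Finset.card_filter_add_card_filter_not (s := A.filter fun b => b ∉ A.image Box.right)
      (fun b => b ∈ A.image Box.down),
    ← Finset.card_filter_add_card_filter_not (s := A.filter fun b => b ∈ A.image Box.down ∧
      (b ∉ A.image Box.right ∨ b ∉ A.image Box.diag)) (fun b => b ∈ A.image Box.right)]
  simp only [Finset.filter_filter]
  have e1 : (A.filter fun b => b ∉ A.image Box.down ∧ b ∉ A.image Box.right) =
      A.filter fun b => b ∉ A.image Box.right ∧ b ∉ A.image Box.down :=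
    Finset.filter_congr fun b _ => by tauto
  have e2 : (A.filter fun b => (b ∈ A.image Box.down ∧
      (b ∉ A.image Box.right ∨ b ∉ A.image Box.diag)) ∧ b ∈ A.image Box.right) =
      A.filter fun b => b ∈ A.image Box.down ∧ b ∈ A.image Box.right ∧ b ∉ A.image Box.diag :=
    Finset.filter_congr fun b _ => by tauto
  have e3 : (A.filter fun b => (b ∈ A.image Box.down ∧
      (b ∉ A.image Box.right ∨ b ∉ A.image Box.diag)) ∧ b ∉ A.image Box.right) =
      A.filter fun b => b ∉ A.image Box.right ∧ b ∈ A.image Box.down :=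
    Finset.filter_congr fun b _ => by tauto
  rw [e1, e2, e3]
  ring

lemma IsConvex.card_dull_lt_card_sharp {A : Finset (Box r)} (hA : IsConvex A)
    (hne : A.Nonempty) : (dull A).card < (sharp A).card := by
  have h1 := hA.card_sharp_add
  have h2 := card_joinedRows_lt hne
  omega

/-! ### Linear extensions and their first box. -/

/-- `a` precedes `b` in a row or a column. -/
def Precedes (a b : Box r) : Prop :=
  a.1 = b.1 ∧ ((a.2.1 = b.2.1 ∧ a.2.2 < b.2.2) ∨ (a.2.2 = b.2.2 ∧ a.2.1 < b.2.1))

open Classical in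
/-- The enumerations of `n` boxes of `A` which increase along rows and columns. -/
def linearExtensions (A : Finset (Box r)) (n : ℕ) : Finset (Fin n → Box r) :=
  (Fintype.piFinset fun _ : Fin n => A).filter fun w =>
    Function.Injective w ∧ ∀ i j, Precedes (w i) (w j) → i < j

lemma mem_linearExtensions {A : Finset (Box r)} {n : ℕ} {w : Fin n → Box r} :
    w ∈ linearExtensions A n ↔ (∀ i, w i ∈ A) ∧ Function.Injective w ∧
      ∀ i j, Precedes (w i) (w j) → i < j := by
  simp only [linearExtensions, Finset.mem_filter, Fintype.mem_piFinset]

lemma exists_eq_of_mem_linearExtensions {A : Finset (Box r)} {n : ℕ} (hn : A.card = n)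
    {w : Fin n → Box r} (hw : w ∈ linearExtensions A n) {b : Box r} (hb : b ∈ A) :
    ∃ i, w i = b := by
  obtain ⟨h1, h2, -⟩ := mem_linearExtensions.1 hw
  have himg : Finset.univ.image w = A := Finset.eq_of_subset_of_card_le
    (by intro c hc; obtain ⟨i, -, rfl⟩ := Finset.mem_image.1 hc; exact h1 i)
    (by rw [Finset.card_image_of_injective _ h2]; simp [hn])
  obtain ⟨i, -, hi⟩ := Finset.mem_image.1 (himg ▸ hb)
  exact ⟨i, hi⟩

lemma head_mem_sharp {A : Finset (Box r)} {n : ℕ} (hn : A.card = n + 1)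
    {w : Fin (n + 1) → Box r} (hw : w ∈ linearExtensions A (n + 1)) : w 0 ∈ sharp A := by
  obtain ⟨h1, -, h3⟩ := mem_linearExtensions.1 hw
  refine Finset.mem_filter.2 ⟨h1 0, fun h => ?_, fun h => ?_⟩ <;>
  · obtain ⟨c, hc, he⟩ := Finset.mem_image.1 h
    obtain ⟨i, rfl⟩ := exists_eq_of_mem_linearExtensions hn hw hc
    refine absurd (h3 i 0 ?_) (Fin.not_lt_zero i)
    rw [← he]
    simp [Precedes, Box.down, Box.right]

lemma tail_mem_linearExtensions {A : Finset (Box r)} {n : ℕ}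
    {w : Fin (n + 1) → Box r} (hw : w ∈ linearExtensions A (n + 1)) :
    Fin.tail w ∈ linearExtensions (A.erase (w 0)) n := by
  obtain ⟨h1, h2, h3⟩ := mem_linearExtensions.1 hw
  refine mem_linearExtensions.2 ⟨fun i => Finset.mem_erase.2
    ⟨fun h => absurd (h2 h) (Fin.succ_ne_zero i), h1 _⟩, h2.comp (Fin.succ_injective n),
    fun i j h => Fin.succ_lt_succ_iff.1 (h3 _ _ h)⟩

lemma IsConvex.cons_mem_linearExtensions {A : Finset (Box r)} (hA : IsConvex A) {n : ℕ}
    {s : Box r} (hs : s ∈ sharp A) {w : Fin n → Box r}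
    (hw : w ∈ linearExtensions (A.erase s) n) :
    (Fin.cons s w : Fin (n + 1) → Box r) ∈ linearExtensions A (n + 1) := by
  obtain ⟨h1, h2, h3⟩ := mem_linearExtensions.1 hw
  refine mem_linearExtensions.2 ⟨fun i => ?_, ?_, fun i j => ?_⟩
  · cases i using Fin.cases with
    | zero => exact (Finset.mem_filter.1 hs).1
    | succ i => exact (Finset.mem_erase.1 (h1 i)).2
  · refine Fin.cons_injective_iff.2 ⟨?_, h2⟩
    rintro ⟨i, hi⟩
    exact (Finset.mem_erase.1 (h1 i)).1 hi
  · cases j using Fin.cases with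
    | zero =>
      intro h
      exfalso
      cases i using Fin.cases with
      | zero => simp [Precedes] at h
      | succ i =>
        simp only [Fin.cons_succ, Fin.cons_zero] at h
        have hm := (Finset.mem_erase.1 (h1 i)).2
        generalize w i = t at h hm
        obtain ⟨m, a, b⟩ := s
        obtain ⟨m', a', b'⟩ := t
        obtain ⟨rfl, h⟩ := h
        simp only at h
        have := hA.eq_of_le_sharp hs hm (by omega) (by omega)
        omega
    | succ j =>
      cases i using Fin.cases with
      | zero => exact fun _ => Fin.succ_pos j
      | succ i => exact fun h => Fin.succ_lt_succ_iff.2 (h3 _ _ h)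

/-- The recursion behind the induction: the first box is minimal, hence a sharp corner, and any
sharp corner may be put in front of an enumeration of the rest. -/
lemma IsConvex.sum_linearExtensions_succ {A : Finset (Box r)} (hA : IsConvex A) {n : ℕ}
    (hn : A.card = n + 1) {M : Type*} [AddCommMonoid M] (f : Box r → (Fin n → Box r) → M) :
    ∑ w ∈ linearExtensions A (n + 1), f (w 0) (Fin.tail w) =
      ∑ s ∈ sharp A, ∑ w ∈ linearExtensions (A.erase s) n, f s w := by
  rw [Finset.sum_sigma']
  refine Finset.sum_bij' (fun w _ => ⟨w 0, Fin.tail w⟩) (fun a _ => Fin.cons a.1 a.2)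
    (fun w hw => Finset.mem_sigma.2 ⟨head_mem_sharp hn hw, tail_mem_linearExtensions hw⟩)
    (fun a ha => hA.cons_mem_linearExtensions (Finset.mem_sigma.1 ha).1 (Finset.mem_sigma.1 ha).2)
    (fun w _ => Fin.cons_self_tail w) (fun a _ => by simp) (fun w _ => rfl)

lemma sharp_subset (A : Finset (Box r)) : sharp A ⊆ A := Finset.filter_subset _ _

lemma dull_subset (A : Finset (Box r)) : dull A ⊆ A := Finset.filter_subset _ _

/-! ### Greene's theorem for convex sets of boxes. -/

section Weights

variable {K : Type*}

/-- Keeps the denominators nonzero when the induction hypothesis is used at `z = x s`: a box further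
down the diagonal of `s` still has a box above it after `s` is removed, so it is not sharp. -/
lemma IsConvex.ne_of_mem_sharp_erase {A : Finset (Box r)} (hA : IsConvex A) {x : Box r → K}
    (hx : SeparatesDiagonals x) {s t : Box r} (hs : s ∈ sharp A) (ht : t ∈ sharp (A.erase s)) :
    x s ≠ x t := by
  obtain ⟨m, i, j⟩ := s
  obtain ⟨m', i', j'⟩ := t
  intro h
  obtain ⟨h1, h2⟩ := (hx _ _).1 h
  simp only at h1 h2
  subst h1
  have hsA := (Finset.mem_filter.1 hs).1
  obtain ⟨htA, ht1, -⟩ := Finset.mem_filter.1 ht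
  obtain ⟨hne, htA⟩ := Finset.mem_erase.1 htA
  have hlt : i < i' := by
    by_contra hcon
    have := hA.eq_of_le_sharp hs htA (by omega) (by omega)
    apply hne
    rw [this.1, this.2]
  refine ht1 (mem_image_down.2 ⟨i' - 1, by omega, Finset.mem_erase.2 ⟨?_, ?_⟩⟩)
  · simp only [ne_eq, Prod.mk.injEq, true_and, not_and]
    omega
  · exact hA m i j (i' - 1) j' i' j' hsA htA (by omega) (by omega) (by omega) le_rfl

/-- Two boxes on one diagonal are comparable, while sharp corners are minimal. -/
lemma IsConvex.injOn_sharp {A : Finset (Box r)} (hA : IsConvex A) {x : Box r → K}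
    (hx : SeparatesDiagonals x) : Set.InjOn x (sharp A) := by
  rintro ⟨m, i, j⟩ hs ⟨m', i', j'⟩ ht h
  obtain ⟨h1, h2⟩ := (hx _ _).1 h
  simp only at h1 h2
  subst h1
  have hsA := (Finset.mem_filter.1 (Finset.mem_coe.1 hs)).1
  have htA := (Finset.mem_filter.1 (Finset.mem_coe.1 ht)).1
  rcases le_total i i' with hle | hle
  · obtain ⟨rfl, rfl⟩ := hA.eq_of_le_sharp ht hsA hle (by omega)
    rfl
  · obtain ⟨rfl, rfl⟩ := hA.eq_of_le_sharp hs htA hle (by omega)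
    rfl

variable [Field K]

/-- `∏ i, (x (w (i - 1)) - x (w i))⁻¹`, where the first factor is `(z - x (w 0))⁻¹`. -/
def chainWeight (x : Box r → K) {n : ℕ} (z : K) (w : Fin n → Box r) : K :=
  ∏ i : Fin n, ((Fin.cons z (x ∘ w) : Fin (n + 1) → K) i.castSucc - x (w i))⁻¹

lemma chainWeight_succ (x : Box r → K) {n : ℕ} (z : K) (w : Fin (n + 1) → Box r) :
    chainWeight x z w = (z - x (w 0))⁻¹ * chainWeight x (x (w 0)) (Fin.tail w) := by
  rw [chainWeight, Fin.prod_univ_succ, chainWeight]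
  congr 1
  refine Finset.prod_congr rfl fun i _ => ?_
  congr 2
  rw [← Fin.succ_castSucc, Fin.cons_succ]
  refine Fin.cases ?_ (fun j => ?_) i.castSucc <;> rfl

lemma dull_inter_erase_sharp {A : Finset (Box r)} {s : Box r} (hs : s ∈ sharp A) :
    dull A ∩ A.erase s = dull A := by
  refine Finset.inter_eq_left.2 fun d hd => Finset.mem_erase.2
    ⟨?_, (Finset.mem_filter.1 hd).1⟩
  rintro rfl
  exact (Finset.mem_filter.1 hs).2.1 (Finset.mem_filter.1 hd).2.1

lemma sharp_inter_erase (A : Finset (Box r)) (s : Box r) :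
    sharp A ∩ A.erase s = (sharp A).erase s := by
  ext b
  simp only [sharp, Finset.mem_inter, Finset.mem_erase, Finset.mem_filter]
  tauto

/-- A variant of Greene's theorem on sums over linear extensions. -/
theorem IsConvex.sum_chainWeight {x : Box r → K} (hx : SeparatesDiagonals x) (n : ℕ) :
    ∀ {A : Finset (Box r)}, IsConvex A → A.card = n → ∀ z : K, (∀ s ∈ sharp A, z ≠ x s) →
      ∑ w ∈ linearExtensions A n, chainWeight x z w =
        edgeProd x A * ∏ b ∈ A, (z - x b) ^ cornerExp A b := by
  induction n with
  | zero =>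
    intro A _ hn z _
    obtain rfl := Finset.card_eq_zero.1 hn
    have : linearExtensions (∅ : Finset (Box r)) 0 = {Fin.elim0} := by
      ext w
      simp only [mem_linearExtensions, Finset.mem_singleton]
      exact ⟨fun _ => Subsingleton.elim _ _, fun _ => ⟨fun i => i.elim0, fun i => i.elim0,
        fun i => i.elim0⟩⟩
    rw [this]
    simp [chainWeight, edgeProd]
  | succ n ih =>
    intro A hA hn z hz
    have hne : A.Nonempty := Finset.card_pos.1 (by omega)
    simp only [chainWeight_succ]
    rw [hA.sum_linearExtensions_succ hn fun s w => (z - x s)⁻¹ * chainWeight x (x s) w]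
    rw [hA.prod_zpow_cornerExp subset_rfl, Finset.inter_eq_left.2 (dull_subset A),
      Finset.inter_eq_left.2 (sharp_subset A),
      -- The right side is expanded in partial fractions in `z`; its terms are then matched with the
      -- possible first boxes.
      ← sum_inv_sub_mul_prod_div_prod _ _ x (hA.injOn_sharp hx) (hA.card_dull_lt_card_sharp hne) z
        hz, Finset.mul_sum]
    refine Finset.sum_congr rfl fun s hs => ?_
    rw [← Finset.mul_sum, ih (hA.erase_sharp hs)
      (by rw [Finset.card_erase_of_mem (Finset.mem_filter.1 hs).1, hn, Nat.add_sub_cancel])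
      (x s) (fun t ht => hA.ne_of_mem_sharp_erase hx hs ht), hA.edgeProd_mul_prod_erase hx hs,
      hA.prod_zpow_cornerExp (Finset.erase_subset _ _), dull_inter_erase_sharp hs,
      sharp_inter_erase]
    ring

/-- The same recursion with an arbitrary weight `f` on the first box in place of `(z - x s)⁻¹`. -/
lemma IsConvex.sum_head_mul_chainWeight {x : Box r → K} (hx : SeparatesDiagonals x) {n : ℕ}
    {A : Finset (Box r)} (hA : IsConvex A) (hn : A.card = n + 1) (f : Box r → K) :
    ∑ w ∈ linearExtensions A (n + 1), f (w 0) * chainWeight x (x (w 0)) (Fin.tail w) =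
      edgeProd x A * ∑ s ∈ sharp A, f s *
        ((∏ d ∈ dull A, (x s - x d)) / ∏ t ∈ (sharp A).erase s, (x s - x t)) := by
  rw [hA.sum_linearExtensions_succ hn fun s w => f s * chainWeight x (x s) w, Finset.mul_sum]
  refine Finset.sum_congr rfl fun s hs => ?_
  rw [← Finset.mul_sum, IsConvex.sum_chainWeight hx n (hA.erase_sharp hs)
    (by rw [Finset.card_erase_of_mem (Finset.mem_filter.1 hs).1, hn, Nat.add_sub_cancel])
    (x s) (fun t ht => hA.ne_of_mem_sharp_erase hx hs ht), hA.edgeProd_mul_prod_erase hx hs,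
    hA.prod_zpow_cornerExp (Finset.erase_subset _ _), dull_inter_erase_sharp hs,
    sharp_inter_erase]
  ring

end Weights

/-! ### Contents in the field of rational functions. -/

lemma u_ne_zero (m : Fin r) : (u m : RatField r) ≠ 0 := by
  simp [u, MvPolynomial.X_ne_zero]

lemma q_ne_zero : (q : RatField r) ≠ 0 := by
  simp [q, MvPolynomial.X_ne_zero]

lemma ct_ne_zero (b : Box r) : ct b ≠ 0 :=
  mul_ne_zero (u_ne_zero _) (zpow_ne_zero _ q_ne_zero)

lemma u_mul_q_pow_inj {m m' : Fin r} {k k' : ℕ}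
    (h : (u m : RatField r) * q ^ k = u m' * q ^ k') : m = m' ∧ k = k' := by
  simp only [u, q, ← map_pow, ← map_mul] at h
  have h := IsFractionRing.injective (MvPolynomial (Fin r ⊕ Unit) ℂ) (RatField r) h
  rw [MvPolynomial.X_pow_eq_monomial, MvPolynomial.X_pow_eq_monomial, MvPolynomial.X,
    MvPolynomial.X, MvPolynomial.monomial_mul, MvPolynomial.monomial_mul, one_mul] at h
  have h := MvPolynomial.monomial_left_injective one_ne_zero h
  constructor
  · by_contra hne
    have := DFunLike.congr_fun h (Sum.inl m)
    simp [Ne.symm hne] at this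
  · have := DFunLike.congr_fun h (Sum.inr ())
    simpa using this

lemma separatesDiagonals_ct : SeparatesDiagonals (ct (r := r)) := by
  rintro ⟨m, i, j⟩ ⟨m', i', j'⟩
  have hq := q_ne_zero (r := r)
  -- A common power of `q` clears the negative exponents, so that monomials of the polynomial ring
  -- can be compared.
  have key : ∀ (m : Fin r) (i j i' : ℕ), ct (m, i, j) * q ^ (2 * (i + i')) =
      (u m : RatField r) * q ^ (2 * (j + i')) := by
    intro m i j i'
    simp only [ct, Box.comp, Box.row, Box.col]
    rw [mul_assoc, ← zpow_natCast, ← zpow_natCast, ← zpow_add₀ hq]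
    congr 2
    push_cast
    ring
  have h1 := key m i j i'
  have h2 := key m' i' j' i
  rw [add_comm i' i] at h2
  constructor
  · intro h
    rw [h, h2] at h1
    obtain ⟨e1, e2⟩ := u_mul_q_pow_inj h1
    exact ⟨e1.symm, by simp only; omega⟩
  · rintro ⟨e1, e2⟩
    simp only at e1 e2
    subst e1
    rw [← e2, ← h1] at h2
    exact (mul_right_cancel₀ (pow_ne_zero _ hq) h2).symm

lemma ct_right (b : Box r) : ct b.right = ct b * q ^ 2 := by
  simp only [ct, Box.right, Box.comp, Box.row, Box.col]
  rw [mul_assoc, ← zpow_natCast q 2, ← zpow_add₀ q_ne_zero]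
  congr 2
  push_cast
  ring

lemma ct_down (b : Box r) : ct b.down * q ^ 2 = ct b := by
  simp only [ct, Box.down, Box.comp, Box.row, Box.col]
  rw [mul_assoc, ← zpow_natCast q 2, ← zpow_add₀ q_ne_zero]
  congr 2
  push_cast
  ring

/-- Along an edge the difference is a constant multiple of the content at the far end, so the edge
product becomes a monomial in contents up to a constant. -/
lemma ct_sub_ct_right (b : Box r) :
    ct b - ct b.right = -(q⁻¹ * (q - q⁻¹)) * ct b.right := by
  have hq := q_ne_zero (r := r)
  rw [ct_right]
  field_simp
  ring

lemma ct_sub_ct_down (b : Box r) : ct b - ct b.down = (q * (q - q⁻¹)) * ct b.down := by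
  have hq := q_ne_zero (r := r)
  rw [← ct_down b]
  field_simp

lemma q_sub_inv_ne_zero (m : Fin r) : (q : RatField r) - q⁻¹ ≠ 0 := by
  intro h
  have h1 := ct_sub_ct_right ((m, 0, 0) : Box r)
  rw [h, mul_zero, neg_zero, zero_mul] at h1
  have := ((separatesDiagonals_ct _ _).1 (sub_eq_zero.1 h1)).2
  simp [Box.right] at this

lemma div_one_sub_div {K : Type*} [Field K] (a x : K) {y : K} (hy : y ≠ 0) :
    a / (1 - x / y) = -a * y * (x - y)⁻¹ := by
  rw [one_sub_div hy, div_div_eq_mul_div, ← neg_sub y, ← neg_inv]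
  ring

/-! ### From shapes and tableaux to convex sets and linear extensions. -/

namespace Shape

variable (S : Shape r)

lemma mem_boxes {m : Fin r} {i j : ℕ} :
    (m, i, j) ∈ S.boxes ↔ (i, j) ∈ S.outer m ∧ (i, j) ∉ S.inner m := by
  simp [boxes]

lemma isConvex_boxes : IsConvex S.boxes := by
  intro m i j i' j' i'' j'' h h'' h1 h2 h3 h4
  rw [mem_boxes] at *
  exact ⟨(S.outer m).up_left_mem h2 h4 h''.1, fun h' => h.2 ((S.inner m).up_left_mem h1 h3 h')⟩

lemma hasAbove_iff (b : Box r) : S.HasAbove b ↔ b ∈ S.boxes.image Box.down :=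
  mem_image_down.symm

lemma hasLeft_iff (b : Box r) : S.HasLeft b ↔ b ∈ S.boxes.image Box.right :=
  mem_image_right.symm

lemma hasNorthwest_iff (b : Box r) : S.HasNorthwest b ↔ b ∈ S.boxes.image Box.diag := by
  obtain ⟨m, i, j⟩ := b
  exact mem_image_diag.symm

lemma SC_eq_sharp : S.SC = sharp S.boxes := by
  ext b
  simp only [SC, sharp, Finset.mem_filter, hasAbove_iff, hasLeft_iff]

lemma DC_eq_dull : S.DC = dull S.boxes := by
  ext b
  simp only [DC, dull, Finset.mem_filter, hasAbove_iff, hasLeft_iff, hasNorthwest_iff]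
  tauto

lemma isBrokenBorderStrip_iff : S.IsBrokenBorderStrip ↔ ∀ b ∈ S.boxes, b.diag ∉ S.boxes := by
  constructor
  · rintro h ⟨m, i, j⟩ hb hd
    exact h ⟨m, i, j, hb,
      S.isConvex_boxes m i j i (j + 1) (i + 1) (j + 1) hb hd (by omega) (by omega) (by omega)
        (by omega),
      S.isConvex_boxes m i j (i + 1) j (i + 1) (j + 1) hb hd (by omega) (by omega) (by omega)
        (by omega), hd⟩
  · rintro h ⟨m, i, j, hb, -, -, hd⟩
    exact h _ hb hd

lemma edgeProd_eq_zero (h : ¬ S.IsBrokenBorderStrip) {K : Type*} [Field K] (x : Box r → K) :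
    edgeProd x S.boxes = 0 := by
  rw [isBrokenBorderStrip_iff] at h
  push Not at h
  obtain ⟨b, hb, hd⟩ := h
  exact Finset.prod_eq_zero hb (by simp [edgeFactor, hd])

lemma StandardTableau.box_mem_linearExtensions {S : Shape r} {n : ℕ} (L : S.StandardTableau n) :
    L.box ∈ linearExtensions S.boxes n := by
  refine mem_linearExtensions.2 ⟨fun i => (L.1.symm i).2,
    Subtype.val_injective.comp L.1.symm.injective, fun i j h => ?_⟩
  obtain ⟨h1, h2 | h2⟩ := h
  · simpa using L.2.1 (L.1.symm i) (L.1.symm j) h1 h2.1 h2.2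
  · simpa using L.2.2 (L.1.symm i) (L.1.symm j) h1 h2.1 h2.2

lemma sum_standardTableau {n : ℕ} (hn : S.boxes.card = n) {M : Type*} [AddCommMonoid M]
    (f : (Fin n → Box r) → M) :
    ∑ L : S.StandardTableau n, f L.box = ∑ w ∈ linearExtensions S.boxes n, f w := by
  refine Finset.sum_bij (fun L _ => L.box) (fun L _ => L.box_mem_linearExtensions) ?_ ?_
    (fun _ _ => rfl)
  · intro L _ L' _ h
    apply Subtype.ext
    apply Equiv.symm_bijective.injective
    ext1 i
    exact Subtype.ext (congrFun h i)
  · intro w hw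
    obtain ⟨h1, h2, h3⟩ := mem_linearExtensions.1 hw
    let e : Fin n ≃ {b : Box r // b ∈ S.boxes} := Equiv.ofBijective (fun i => ⟨w i, h1 i⟩)
      ⟨fun i j h => h2 (congrArg Subtype.val h), fun b => by
        obtain ⟨i, hi⟩ := exists_eq_of_mem_linearExtensions hn hw b.2
        exact ⟨i, Subtype.ext hi⟩⟩
    have he : ∀ b, w (e.symm b) = b.1 := fun b => congrArg Subtype.val (e.apply_symm_apply b)
    refine ⟨⟨e.symm, fun a b h h' h'' => h3 _ _ ?_, fun a b h h' h'' => h3 _ _ ?_⟩,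
      Finset.mem_univ _, ?_⟩
    · rw [he, he]
      exact ⟨h, Or.inl ⟨h', h''⟩⟩
    · rw [he, he]
      exact ⟨h, Or.inr ⟨h', h''⟩⟩
    · rfl

lemma prod_eq_of_mem_linearExtensions {A : Finset (Box r)} {n : ℕ} (hn : A.card = n)
    {w : Fin n → Box r} (hw : w ∈ linearExtensions A n) {M : Type*} [CommMonoid M]
    (f : Box r → M) : ∏ i, f (w i) = ∏ b ∈ A, f b := by
  obtain ⟨h1, h2, -⟩ := mem_linearExtensions.1 hw
  refine Finset.prod_bij (fun i _ => w i) (fun i _ => h1 i) (fun i _ j _ h => h2 h) ?_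
    (fun _ _ => rfl)
  intro b hb
  obtain ⟨i, hi⟩ := exists_eq_of_mem_linearExtensions hn hw hb
  exact ⟨i, Finset.mem_univ _, hi⟩

/-- The factors of a tableau supply the contents of all boxes but the first. Completing the product
costs one power of the first content, hence the integer exponent `k - 1`. -/
lemma delta_eq_edgeProd_mul {p : ℕ} (hcard : S.boxes.card = p + 1) (k : ℕ) :
    S.delta p k = (-(q - q⁻¹)) ^ p * (∏ b ∈ S.boxes, ct b) * edgeProd ct S.boxes *
      ∑ s ∈ S.SC, ct s ^ ((k : ℤ) - 1) *
        ((∏ d ∈ S.DC, (ct s - ct d)) / ∏ t ∈ S.SC.erase s, (ct s - ct t)) := by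
  rw [delta, SC_eq_sharp, DC_eq_dull, mul_assoc,
    ← S.isConvex_boxes.sum_head_mul_chainWeight separatesDiagonals_ct hcard, Finset.mul_sum]
  simp only [StandardTableau.delta]
  rw [S.sum_standardTableau hcard fun w => ct (w 0) ^ k *
    ∏ i : Fin p, (q - q⁻¹) / (1 - ct (w i.castSucc) / ct (w i.succ))]
  refine Finset.sum_congr rfl fun w hw => ?_
  rw [← prod_eq_of_mem_linearExtensions hcard hw, Fin.prod_univ_succ, chainWeight,
    zpow_sub_one₀ (ct_ne_zero _), zpow_natCast]
  have hfac : ∀ i : Fin p, (q - q⁻¹) / (1 - ct (w i.castSucc) / ct (w i.succ)) =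
      (-(q - q⁻¹)) * ct (w i.succ) * ((Fin.cons (ct (w 0)) (ct ∘ Fin.tail w) :
        Fin (p + 1) → RatField r) i.castSucc - ct (Fin.tail w i))⁻¹ := by
    intro i
    have hc : (Fin.cons (ct (w 0)) (ct ∘ Fin.tail w) : Fin (p + 1) → RatField r) = ct ∘ w :=
      Fin.cons_self_tail (ct ∘ w)
    rw [hc]
    change _ = -(q - q⁻¹) * ct (w i.succ) * (ct (w i.castSucc) - ct (w i.succ))⁻¹
    exact div_one_sub_div _ _ (ct_ne_zero _)
  rw [Finset.prod_congr rfl fun i _ => hfac i, Finset.prod_mul_distrib, Finset.prod_mul_distrib,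
    Finset.prod_const, Finset.card_univ, Fintype.card_fin]
  have h0 := ct_ne_zero (w 0)
  field_simp

end Shape

lemma prod_zpow_eq_zpow_sum₀ {ι K : Type*} [Field K] {a : K} (ha : a ≠ 0) (s : Finset ι)
    (f : ι → ℤ) : ∏ i ∈ s, a ^ f i = a ^ ∑ i ∈ s, f i := by
  classical
  induction s using Finset.induction_on with
  | empty => simp
  | insert i s hi ih => rw [Finset.prod_insert hi, Finset.sum_insert hi, zpow_add₀ ha, ih]

/-! ### Connected components, their rows and their columns. -/

namespace Shape

variable (S : Shape r)

lemma reachable_right {m : Fin r} {i j : ℕ} (h : (m, i, j) ∈ S.boxes)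
    (h' : (m, i, j + 1) ∈ S.boxes) : S.adjGraph.Reachable ⟨_, h⟩ ⟨_, h'⟩ :=
  SimpleGraph.Adj.reachable ⟨rfl, Or.inl ⟨rfl, Or.inl rfl⟩⟩

lemma reachable_down {m : Fin r} {i j : ℕ} (h : (m, i, j) ∈ S.boxes)
    (h' : (m, i + 1, j) ∈ S.boxes) : S.adjGraph.Reachable ⟨_, h⟩ ⟨_, h'⟩ :=
  SimpleGraph.Adj.reachable ⟨rfl, Or.inr ⟨rfl, Or.inl rfl⟩⟩

lemma reachable_of_rowIndex_eq (a b : {b : Box r // b ∈ S.boxes})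
    (h : a.1.rowIndex = b.1.rowIndex) : S.adjGraph.Reachable a b := by
  have aux : ∀ (m : Fin r) (i j d : ℕ) (h : (m, i, j) ∈ S.boxes) (h' : (m, i, j + d) ∈ S.boxes),
      S.adjGraph.Reachable ⟨_, h⟩ ⟨_, h'⟩ := by
    intro m i j d
    induction d with
    | zero => exact fun _ _ => SimpleGraph.Reachable.refl _
    | succ d ih =>
      intro h h'
      have hd : (m, i, j + d) ∈ S.boxes := S.isConvex_boxes m i j i (j + d) i (j + (d + 1)) h h'
        le_rfl le_rfl (by omega) (by omega)
      exact (ih h hd).trans (S.reachable_right hd h')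
  obtain ⟨⟨m, i, j⟩, ha⟩ := a
  obtain ⟨⟨m', i', j'⟩, hb⟩ := b
  obtain ⟨rfl, rfl⟩ : m = m' ∧ i = i' := by simpa [Box.rowIndex] using h
  rcases le_total j j' with hle | hle
  · obtain ⟨d, rfl⟩ := Nat.exists_eq_add_of_le hle
    exact aux m i j d ha hb
  · obtain ⟨d, rfl⟩ := Nat.exists_eq_add_of_le hle
    exact (aux m i j' d hb ha).symm

lemma reachable_of_colIndex_eq (a b : {b : Box r // b ∈ S.boxes})
    (h : a.1.colIndex = b.1.colIndex) : S.adjGraph.Reachable a b := by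
  have aux : ∀ (m : Fin r) (i j d : ℕ) (h : (m, i, j) ∈ S.boxes) (h' : (m, i + d, j) ∈ S.boxes),
      S.adjGraph.Reachable ⟨_, h⟩ ⟨_, h'⟩ := by
    intro m i j d
    induction d with
    | zero => exact fun _ _ => SimpleGraph.Reachable.refl _
    | succ d ih =>
      intro h h'
      have hd : (m, i + d, j) ∈ S.boxes := S.isConvex_boxes m i j (i + d) j (i + (d + 1)) j h h'
        (by omega) (by omega) le_rfl le_rfl
      exact (ih h hd).trans (S.reachable_down hd h')
  obtain ⟨⟨m, i, j⟩, ha⟩ := a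
  obtain ⟨⟨m', i', j'⟩, hb⟩ := b
  obtain ⟨rfl, rfl⟩ : m = m' ∧ j = j' := by simpa [Box.colIndex] using h
  rcases le_total i i' with hle | hle
  · obtain ⟨d, rfl⟩ := Nat.exists_eq_add_of_le hle
    exact aux m i j d ha hb
  · obtain ⟨d, rfl⟩ := Nat.exists_eq_add_of_le hle
    exact (aux m i' j d hb ha).symm

lemma mem_componentBoxes {C : S.Component} {b : Box r} : b ∈ S.componentBoxes C ↔
    ∃ h : b ∈ S.boxes, S.adjGraph.connectedComponentMk ⟨b, h⟩ = C := by
  simp only [componentBoxes, Finset.mem_image, Finset.mem_filter, Finset.mem_univ, true_and]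
  constructor
  · rintro ⟨a, h, rfl⟩
    exact ⟨a.2, h⟩
  · rintro ⟨h, hC⟩
    exact ⟨⟨b, h⟩, hC, rfl⟩

lemma comp_eq_of_reachable {a b : {b : Box r // b ∈ S.boxes}} (h : S.adjGraph.Reachable a b) :
    a.1.1 = b.1.1 := by
  obtain ⟨p⟩ := h
  induction p with
  | nil => rfl
  | cons h _ ih => exact h.1.trans ih

/-- If boxes with the same index are connected, then each index occurs in one component. -/
lemma sum_card_image_componentBoxes {β : Type*} [DecidableEq β] (f : Box r → β)
    (hf : ∀ a b : {b : Box r // b ∈ S.boxes}, f a.1 = f b.1 → S.adjGraph.Reachable a b) :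
    ∑ C : S.Component, ((S.componentBoxes C).image f).card = (S.boxes.image f).card := by
  rw [← Finset.card_biUnion]
  · congr 1
    ext x
    simp only [Finset.mem_biUnion, Finset.mem_univ, true_and, Finset.mem_image,
      mem_componentBoxes]
    constructor
    · rintro ⟨C, b, ⟨h, -⟩, rfl⟩
      exact ⟨b, h, rfl⟩
    · rintro ⟨b, h, rfl⟩
      exact ⟨_, b, ⟨h, rfl⟩, rfl⟩
  · intro C _ C' _ hne
    refine Finset.disjoint_left.2 fun x hx hx' => hne ?_
    obtain ⟨b, hb, rfl⟩ := Finset.mem_image.1 hx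
    obtain ⟨b', hb', he⟩ := Finset.mem_image.1 hx'
    obtain ⟨h, rfl⟩ := S.mem_componentBoxes.1 hb
    obtain ⟨h', rfl⟩ := S.mem_componentBoxes.1 hb'
    exact SimpleGraph.ConnectedComponent.eq.2 (hf ⟨b, h⟩ ⟨b', h'⟩ he.symm)

lemma comp_eq_of_mem_componentBoxes {C : S.Component} {a b : Box r}
    (ha : a ∈ S.componentBoxes C) (hb : b ∈ S.componentBoxes C) : a.1 = b.1 := by
  obtain ⟨h, rfl⟩ := S.mem_componentBoxes.1 ha
  obtain ⟨h', he⟩ := S.mem_componentBoxes.1 hb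
  exact (S.comp_eq_of_reachable (SimpleGraph.ConnectedComponent.eq.1 he)).symm

/-- A component lies in one diagram, so the row number alone determines the row. -/
lemma numRows_eq (C : S.Component) :
    S.numRows C = ((S.componentBoxes C).image Box.rowIndex).card := by
  have : (S.componentBoxes C).image Box.row =
      ((S.componentBoxes C).image Box.rowIndex).image Prod.snd := by
    rw [Finset.image_image]
    rfl
  rw [numRows, this, Finset.card_image_of_injOn]
  intro x hx y hy h
  obtain ⟨a, ha, rfl⟩ := Finset.mem_image.1 (Finset.mem_coe.1 hx)
  obtain ⟨b, hb, rfl⟩ := Finset.mem_image.1 (Finset.mem_coe.1 hy)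
  exact Prod.ext (S.comp_eq_of_mem_componentBoxes ha hb) h

lemma numCols_eq (C : S.Component) :
    S.numCols C = ((S.componentBoxes C).image Box.colIndex).card := by
  have : (S.componentBoxes C).image Box.col =
      ((S.componentBoxes C).image Box.colIndex).image Prod.snd := by
    rw [Finset.image_image]
    rfl
  rw [numCols, this, Finset.card_image_of_injOn]
  intro x hx y hy h
  obtain ⟨a, ha, rfl⟩ := Finset.mem_image.1 (Finset.mem_coe.1 hx)
  obtain ⟨b, hb, rfl⟩ := Finset.mem_image.1 (Finset.mem_coe.1 hy)
  exact Prod.ext (S.comp_eq_of_mem_componentBoxes ha hb) h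

/-- Each row and each column of a diagram is connected, hence meets one component only; the
exponents add up to global counts. -/
lemma stripProduct_eq : S.stripProduct =
    q ^ (((S.boxes.image Box.colIndex).card : ℤ) - S.cc) *
      (-q⁻¹) ^ (((S.boxes.image Box.rowIndex).card : ℤ) - S.cc) := by
  rw [stripProduct, Finset.prod_mul_distrib, prod_zpow_eq_zpow_sum₀ q_ne_zero,
    prod_zpow_eq_zpow_sum₀ (neg_ne_zero.2 (inv_ne_zero q_ne_zero)),
    ← S.sum_card_image_componentBoxes Box.colIndex S.reachable_of_colIndex_eq,
    ← S.sum_card_image_componentBoxes Box.rowIndex S.reachable_of_rowIndex_eq, cc]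
  simp [numRows_eq, numCols_eq]

/-- The row which is reached from row `i` by going up while the row is joined to the row
above. -/
def topRow (m : Fin r) : ℕ → ℕ
  | 0 => 0
  | i + 1 => if (m, i + 1) ∈ joinedRows S.boxes then topRow m i else i + 1

lemma topRow_eq_of_adj {a b : {b : Box r // b ∈ S.boxes}} (h : S.adjGraph.Adj a b) :
    S.topRow a.1.1 a.1.2.1 = S.topRow b.1.1 b.1.2.1 := by
  have aux : ∀ (m : Fin r) (i j : ℕ), (m, i, j) ∈ S.boxes → (m, i + 1, j) ∈ S.boxes →
      S.topRow m (i + 1) = S.topRow m i := by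
    intro m i j h h'
    rw [topRow, if_pos (mem_joinedRows.2 ⟨i, j, rfl, h', h⟩)]
  obtain ⟨⟨m, i, j⟩, ha⟩ := a
  obtain ⟨⟨m', i', j'⟩, hb⟩ := b
  obtain ⟨h1, h2⟩ := h
  simp only [Box.comp, Box.row, Box.col] at h1 h2
  subst h1
  rcases h2 with ⟨rfl, -⟩ | ⟨rfl, rfl | rfl⟩
  · rfl
  · exact (aux _ _ _ ha hb).symm
  · exact aux _ _ _ hb ha

lemma topRow_eq_of_reachable {a b : {b : Box r // b ∈ S.boxes}}
    (h : S.adjGraph.Reachable a b) : S.topRow a.1.1 a.1.2.1 = S.topRow b.1.1 b.1.2.1 := by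
  obtain ⟨p⟩ := h
  induction p with
  | nil => rfl
  | cons h _ ih => exact (S.topRow_eq_of_adj h).trans ih

lemma exists_reachable_topRow (m : Fin r) (i : ℕ) : ∀ (j : ℕ) (h : (m, i, j) ∈ S.boxes),
    (m, S.topRow m i) ∉ joinedRows S.boxes ∧ ∃ (l : ℕ) (h' : (m, S.topRow m i, l) ∈ S.boxes),
      S.adjGraph.Reachable ⟨_, h⟩ ⟨_, h'⟩ := by
  induction i with
  | zero =>
    intro j h
    refine ⟨fun hJ => ?_, j, h, SimpleGraph.Reachable.refl _⟩
    obtain ⟨k, -, hk, -⟩ := mem_joinedRows.1 hJ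
    simp [topRow] at hk
  | succ i ih =>
    intro j h
    by_cases hJ : (m, i + 1) ∈ joinedRows S.boxes
    · have ht : S.topRow m (i + 1) = S.topRow m i := by rw [topRow, if_pos hJ]
      obtain ⟨k, l, hk, h1, h2⟩ := mem_joinedRows.1 hJ
      obtain rfl : k = i := by omega
      obtain ⟨h3, l', h4, h5⟩ := ih l h2
      rw [ht]
      exact ⟨h3, l', h4, ((S.reachable_of_rowIndex_eq ⟨_, h⟩ ⟨_, h1⟩ rfl).trans
        (S.reachable_down h2 h1).symm).trans h5⟩
    · have ht : S.topRow m (i + 1) = i + 1 := by rw [topRow, if_neg hJ]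
      rw [ht]
      exact ⟨hJ, j, h, SimpleGraph.Reachable.refl _⟩

/-- The components correspond to the rows which are not joined to the row above. -/
lemma cc_eq : S.cc = (S.boxes.image Box.rowIndex \ joinedRows S.boxes).card := by
  rw [cc, ← Finset.card_univ]
  -- The pair of diagram and top row is constant on a component. It determines the component, since
  -- every box is connected to its top row, and a row that is not joined upwards is its own top row.
  refine Finset.card_nbij (fun C : S.Component => C.lift
    (fun b => (b.1.1, S.topRow b.1.1 b.1.2.1)) fun a b p _ =>
      Prod.ext (S.comp_eq_of_reachable ⟨p⟩) (S.topRow_eq_of_reachable ⟨p⟩)) ?_ ?_ ?_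
  · intro C _
    induction C using SimpleGraph.ConnectedComponent.ind with
    | _ b =>
    obtain ⟨⟨m, i, j⟩, hb⟩ := b
    obtain ⟨h1, l, h2, -⟩ := S.exists_reachable_topRow m i j hb
    exact Finset.mem_sdiff.2 ⟨mem_image_rowIndex.2 ⟨l, h2⟩, h1⟩
  · intro C _ C' _ h
    induction C using SimpleGraph.ConnectedComponent.ind with
    | _ b =>
    induction C' using SimpleGraph.ConnectedComponent.ind with
    | _ b' =>
    obtain ⟨⟨m, i, j⟩, hb⟩ := b
    obtain ⟨⟨m', i', j'⟩, hb'⟩ := b'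
    obtain ⟨-, l, h2, h3⟩ := S.exists_reachable_topRow m i j hb
    obtain ⟨-, l', h2', h3'⟩ := S.exists_reachable_topRow m' i' j' hb'
    exact SimpleGraph.ConnectedComponent.eq.2
      ((h3.trans (S.reachable_of_rowIndex_eq ⟨_, h2⟩ ⟨_, h2'⟩ h)).trans h3'.symm)
  · rintro ⟨m, i⟩ hmi
    obtain ⟨h1, h2⟩ := Finset.mem_sdiff.1 (Finset.mem_coe.1 hmi)
    obtain ⟨j, hj⟩ := mem_image_rowIndex.1 h1
    refine ⟨S.adjGraph.connectedComponentMk ⟨_, hj⟩, Finset.mem_coe.2 (Finset.mem_univ _), ?_⟩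
    change (m, S.topRow m i) = (m, i)
    cases i with
    | zero => rfl
    | succ i => rw [topRow, if_neg h2]

lemma cc_add_card_joinedRows :
    S.cc + (joinedRows S.boxes).card = (S.boxes.image Box.rowIndex).card := by
  rw [cc_eq, Finset.card_sdiff_add_card_eq_card (joinedRows_subset _)]

lemma card_SC : S.SC.card = S.DC.card + S.cc := by
  have h1 := S.isConvex_boxes.card_sharp_add
  have h2 := S.cc_add_card_joinedRows
  rw [SC_eq_sharp, DC_eq_dull]
  omega

end Shape

/-! ### Evaluation for broken border strips. -/

lemma prod_ite_mem_image {α M : Type*} [DecidableEq α] [CommMonoid M] (A : Finset α) {f : α → α}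
    (hf : Function.Injective f) (g : α → M) :
    ∏ b ∈ A, (if f b ∈ A then g (f b) else 1) = ∏ c ∈ A with c ∈ A.image f, g c := by
  rw [← Finset.prod_filter]
  refine Finset.prod_bij (fun b _ => f b) (fun b hb => ?_) (fun a _ b _ h => hf h) ?_
    (fun _ _ => rfl)
  · obtain ⟨h1, h2⟩ := Finset.mem_filter.1 hb
    exact Finset.mem_filter.2 ⟨h2, Finset.mem_image_of_mem _ h1⟩
  · intro c hc
    obtain ⟨h1, h2⟩ := Finset.mem_filter.1 hc
    obtain ⟨b, hb, rfl⟩ := Finset.mem_image.1 h2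
    exact ⟨b, Finset.mem_filter.2 ⟨hb, h1⟩, rfl⟩

lemma notMem_image_diag {A : Finset (Box r)} (hA : ∀ b ∈ A, b.diag ∉ A) {b : Box r}
    (hb : b ∈ A) : b ∉ A.image Box.diag := by
  intro h
  obtain ⟨c, hc, rfl⟩ := Finset.mem_image.1 h
  exact hA c hc hb

/-- Each edge contributes a constant and the inverse value of its far end. So a box `b` keeps the
exponent one minus its number of left and upper neighbours, which without blocks is `-cornerExp A
b`. -/
lemma IsConvex.prod_mul_edgeProd {A : Finset (Box r)} (hA : IsConvex A)
    (hblock : ∀ b ∈ A, b.diag ∉ A) {K : Type*} [Field K] {x : Box r → K} (hx : ∀ b, x b ≠ 0)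
    {α β : K} (hα : ∀ b, x b - x b.right = α * x b.right)
    (hβ : ∀ b, x b - x b.down = β * x b.down) :
    (∏ b ∈ A, x b) * edgeProd x A =
      α⁻¹ ^ (A.filter fun b => b ∈ A.image Box.right).card *
        β⁻¹ ^ (A.filter fun b => b ∈ A.image Box.down).card *
        ((∏ s ∈ sharp A, x s) * ∏ d ∈ dull A, (x d)⁻¹) := by
  have h1 : edgeProd x A = (∏ b ∈ A, if b.right ∈ A then (α * x b.right)⁻¹ else 1) *
      ∏ b ∈ A, if b.down ∈ A then (β * x b.down)⁻¹ else 1 := by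
    rw [edgeProd, ← Finset.prod_mul_distrib]
    refine Finset.prod_congr rfl fun b hb => ?_
    rw [edgeFactor, hα, hβ, if_neg (hblock b hb), mul_one]
  have h2 := hA.prod_zpow_cornerExp subset_rfl fun b => (x b)⁻¹
  rw [Finset.inter_eq_left.2 (dull_subset A), Finset.inter_eq_left.2 (sharp_subset A)] at h2
  have h3 : ∏ b ∈ A, (x b)⁻¹ ^ cornerExp A b = (∏ b ∈ A, x b) *
      ((∏ b ∈ A with b ∈ A.image Box.right, (x b)⁻¹) *
        ∏ b ∈ A with b ∈ A.image Box.down, (x b)⁻¹) := by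
    rw [Finset.prod_filter, Finset.prod_filter, ← Finset.prod_mul_distrib,
      ← Finset.prod_mul_distrib]
    refine Finset.prod_congr rfl fun b hb => ?_
    have h0 := inv_ne_zero (hx b)
    rw [cornerExp, if_neg (notMem_image_diag hblock hb), sub_zero, zpow_add₀ h0, zpow_add₀ h0,
      zpow_neg_one, inv_inv]
    split_ifs <;> simp [mul_assoc]
  rw [h1, prod_ite_mem_image A Box.right_injective fun b => (α * x b)⁻¹,
    prod_ite_mem_image A Box.down_injective fun b => (β * x b)⁻¹]
  simp only [mul_inv, Finset.prod_mul_distrib, Finset.prod_const]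
  have h4 : (∏ s ∈ sharp A, x s) * ∏ d ∈ dull A, (x d)⁻¹ =
      (∏ d ∈ dull A, (x d)⁻¹) / ∏ s ∈ sharp A, (x s)⁻¹ := by
    rw [Finset.prod_inv_distrib (s := sharp A), div_inv_eq_mul, mul_comm]
  rw [h4, ← h2, h3]
  ring

/-- The partial fraction identity at `z = 0`; the sign collects the differences `0 - x i`. -/
lemma sum_zpow_neg_one_mul_prod_div_prod {ι K : Type*} [DecidableEq ι] [Field K] (s t : Finset ι)
    (x : ι → K) (hx : Set.InjOn x s) (h0 : ∀ i, x i ≠ 0) (c : ℕ)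
    (hc : s.card = t.card + (c + 1)) :
    ∑ i ∈ s, x i ^ (-1 : ℤ) * ((∏ d ∈ t, (x i - x d)) / ∏ j ∈ s.erase i, (x i - x j)) =
      (-1) ^ c * ((∏ d ∈ t, x d) / ∏ i ∈ s, x i) := by
  have h := sum_inv_sub_mul_prod_div_prod s t x hx (by omega) 0 fun i _ => (h0 i).symm
  simp only [zero_sub, inv_neg, neg_mul, Finset.sum_neg_distrib, Finset.prod_neg] at h
  simp only [zpow_neg_one]
  rw [neg_eq_iff_eq_neg] at h
  rw [h, hc, mul_div_mul_comm, pow_add, pow_succ]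
  have h1 : (-1 : K) ^ c * (-1 : K) ^ c = 1 := by rw [← mul_pow]; simp
  have h2 : (-1 : K) ^ t.card ≠ 0 := by simp
  have h3 : (-1 : K) ^ c ≠ 0 := by simp
  rw [← neg_mul]
  congr 1
  field_simp
  linear_combination -h1

/-- One factor `-δ` is spent on each of the `m` horizontal and `n` vertical edges, and `c` factors
are left. -/
lemma strip_coeff {K : Type*} [Field K] {a δ : K} (ha : a ≠ 0) (hδ : δ ≠ 0) (c m n : ℕ) :
    (-δ) ^ (c + m + n) * ((-(a⁻¹ * δ))⁻¹ ^ m * (a * δ)⁻¹ ^ n) =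
      (-δ) ^ c * (a ^ m * (-a⁻¹) ^ n) := by
  have h1 : -δ * (-(a⁻¹ * δ))⁻¹ = a := by
    rw [inv_neg]
    field_simp
  have h2 : -δ * (a * δ)⁻¹ = -a⁻¹ := by field_simp
  calc _ = (-δ) ^ c * ((-δ * (-(a⁻¹ * δ))⁻¹) ^ m * (-δ * (a * δ)⁻¹) ^ n) := by
        rw [mul_pow, mul_pow]
        ring
    _ = _ := by rw [h1, h2]

namespace Shape

variable (S : Shape r)

lemma cc_pos (h : S.boxes.Nonempty) : 0 < S.cc := by
  have h1 := card_joinedRows_lt h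
  have h2 := S.cc_add_card_joinedRows
  omega

/-- In a broken border strip the boxes are counted by rows, columns and components. -/
lemma card_rows_add_card_cols (h : S.IsBrokenBorderStrip) :
    (S.boxes.image Box.rowIndex).card + (S.boxes.image Box.colIndex).card =
      S.boxes.card + S.cc := by
  rw [isBrokenBorderStrip_iff] at h
  -- An identity at each box; its sum counts rows, columns and dull corners on the left, boxes and
  -- sharp corners on the right.
  have hsum : ∀ b ∈ S.boxes, (if b ∉ S.boxes.image Box.right then 1 else 0) +
      (if b ∉ S.boxes.image Box.down then 1 else 0) + (if b ∈ dull S.boxes then 1 else 0) =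
      1 + (if b ∈ sharp S.boxes then 1 else 0) := by
    intro b hb
    have h3 := notMem_image_diag h hb
    simp only [dull, sharp, Finset.mem_filter, hb, h3, true_and, not_false_eq_true, and_true]
    by_cases h1 : b ∈ S.boxes.image Box.right <;> by_cases h2 : b ∈ S.boxes.image Box.down <;>
      simp only [h1, h2, and_self, and_true, and_false, not_true_eq_false, not_false_eq_true,
        if_true, if_false]
  have := Finset.sum_congr rfl hsum
  simp only [Finset.sum_add_distrib, ← Finset.card_filter, Finset.sum_const, smul_eq_mul,
    mul_one] at this
  rw [S.isConvex_boxes.card_filter_notMem_right, S.isConvex_boxes.card_filter_notMem_down,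
    Finset.filter_mem_eq_inter, Finset.filter_mem_eq_inter,
    Finset.inter_eq_right.2 (dull_subset _), Finset.inter_eq_right.2 (sharp_subset _),
    ← SC_eq_sharp, ← DC_eq_dull, card_SC] at this
  omega

lemma delta_eq_stripProduct_mul {p : ℕ} (hcard : S.boxes.card = p + 1)
    (h : S.IsBrokenBorderStrip) (k : ℕ) :
    S.delta p k = (-q + q⁻¹) ^ ((S.cc : ℤ) - 1) * (∏ s ∈ S.SC, ct s) *
      (∏ d ∈ S.DC, (ct d)⁻¹) * (∑ s ∈ S.SC, ct s ^ ((k : ℤ) - 1) *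
        ((∏ d ∈ S.DC, (ct s - ct d)) / ∏ t ∈ S.SC.erase s, (ct s - ct t))) *
      S.stripProduct := by
  have hne : S.boxes.Nonempty := Finset.card_pos.1 (by omega)
  obtain ⟨⟨m₀, -⟩, -⟩ := id hne
  have hR := S.isConvex_boxes.card_filter_notMem_right
  have hC := S.isConvex_boxes.card_filter_notMem_down
  have hR' := Finset.card_filter_add_card_filter_not (s := S.boxes)
    fun b => b ∈ S.boxes.image Box.right
  have hC' := Finset.card_filter_add_card_filter_not (s := S.boxes)
    fun b => b ∈ S.boxes.image Box.down
  have hRC := S.card_rows_add_card_cols h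
  have hJ := S.cc_add_card_joinedRows
  rw [S.delta_eq_edgeProd_mul hcard, mul_assoc _ (∏ b ∈ S.boxes, ct b),
    S.isConvex_boxes.prod_mul_edgeProd (S.isBrokenBorderStrip_iff.1 h) ct_ne_zero
      ct_sub_ct_right ct_sub_ct_down, stripProduct_eq, ← SC_eq_sharp, ← DC_eq_dull]
  set H := (S.boxes.filter fun b => b ∈ S.boxes.image Box.right).card
  set V := (S.boxes.filter fun b => b ∈ S.boxes.image Box.down).card
  obtain ⟨c, hc⟩ : ∃ c, S.cc = c + 1 := ⟨S.cc - 1, by have := S.cc_pos hne; omega⟩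
  -- Horizontal edges number boxes minus rows, which in a strip is columns minus components; dually
  -- for vertical edges. Thus `p = c + H + V`, as `strip_coeff` requires.
  rw [show ((S.boxes.image Box.colIndex).card : ℤ) - S.cc = (H : ℤ) by omega,
    show ((S.boxes.image Box.rowIndex).card : ℤ) - S.cc = (V : ℤ) by omega,
    show (S.cc : ℤ) - 1 = (c : ℤ) by omega, show p = c + H + V by omega, zpow_natCast,
    zpow_natCast, zpow_natCast, show -q + q⁻¹ = -((q : RatField r) - q⁻¹) by ring]
  linear_combination (∏ s ∈ S.SC, ct s) * (∏ d ∈ S.DC, (ct d)⁻¹) *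
    (∑ s ∈ S.SC, ct s ^ ((k : ℤ) - 1) *
      ((∏ d ∈ S.DC, (ct s - ct d)) / ∏ t ∈ S.SC.erase s, (ct s - ct t))) *
    strip_coeff (q_ne_zero (r := r)) (q_sub_inv_ne_zero m₀) c H V

lemma injOn_ct_SC : Set.InjOn (ct (r := r)) S.SC := by
  rw [SC_eq_sharp]
  exact S.isConvex_boxes.injOn_sharp separatesDiagonals_ct

end Shape

end CyclotomicMN

end

theorem theorem2p17 (r : ℕ) (S : CyclotomicMN.Shape r) (p : ℕ)
    (hcard : S.boxes.card = p + 1) :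
    (¬ S.IsBrokenBorderStrip → ∀ k : ℕ, k < r → S.delta p k = 0) ∧
    (S.IsBrokenBorderStrip →
      S.delta p 0 =
        (CyclotomicMN.q - CyclotomicMN.q⁻¹) ^ ((S.cc : ℤ) - 1) * S.stripProduct ∧
      ∀ k : ℕ, 1 ≤ k → k < r →
        S.delta p k =
          (-CyclotomicMN.q + CyclotomicMN.q⁻¹) ^ ((S.cc : ℤ) - 1) *
            (∏ s ∈ S.SC, CyclotomicMN.ct s) * (∏ d ∈ S.DC, (CyclotomicMN.ct d)⁻¹) *
            (∑ t ∈ Finset.range (S.DC.card + 1),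
              (-1) ^ t * CyclotomicMN.elemSymm S.DC t *
                CyclotomicMN.homSymm S.SC ((k : ℤ) - (t : ℤ) - (S.cc : ℤ))) *
            S.stripProduct) := by
  refine ⟨fun h k _ => ?_, fun h => ⟨?_, fun k hk _ => ?_⟩⟩
  · rw [S.delta_eq_edgeProd_mul hcard, S.edgeProd_eq_zero h, mul_zero, zero_mul]
  · obtain ⟨c, hc⟩ : ∃ c, S.cc = c + 1 :=
      ⟨S.cc - 1, by have := S.cc_pos (Finset.card_pos.1 (by omega)); omega⟩
    have hS : ∏ s ∈ S.SC, CyclotomicMN.ct s ≠ 0 :=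
      Finset.prod_ne_zero_iff.2 fun s _ => CyclotomicMN.ct_ne_zero s
    have hD : ∏ d ∈ S.DC, CyclotomicMN.ct d ≠ 0 :=
      Finset.prod_ne_zero_iff.2 fun d _ => CyclotomicMN.ct_ne_zero d
    have hsum := CyclotomicMN.sum_zpow_neg_one_mul_prod_div_prod S.SC S.DC _ S.injOn_ct_SC
      CyclotomicMN.ct_ne_zero c (by rw [S.card_SC, hc])
    have hk : ((0 : ℕ) : ℤ) - 1 = -1 := rfl
    -- The sign from the evaluation at `0` turns `-q + q⁻¹` into `q - q⁻¹`.
    have hpow : (-CyclotomicMN.q + CyclotomicMN.q⁻¹ : CyclotomicMN.RatField r) ^ c * (-1) ^ c =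
        (CyclotomicMN.q - CyclotomicMN.q⁻¹) ^ c := by
      rw [← mul_pow]
      ring
    rw [S.delta_eq_stripProduct_mul hcard h, hk, hsum, show (S.cc : ℤ) - 1 = (c : ℤ) by omega,
      zpow_natCast, zpow_natCast, ← hpow, Finset.prod_inv_distrib]
    field_simp
  -- For `k ≥ 1` the exponent `k - 1` is a natural number `N`; the index `N + 1 - t - (S.SC.card -
  -- S.DC.card)` is then `k - t - S.cc`.
  · obtain ⟨N, rfl⟩ : ∃ N, k = N + 1 := ⟨k - 1, by omega⟩
    rw [S.delta_eq_stripProduct_mul hcard h]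
    congr 2
    have hN : ((N + 1 : ℕ) : ℤ) - 1 = (N : ℤ) := by push_cast; ring
    simp only [hN, zpow_natCast]
    rw [CyclotomicMN.sum_pow_mul_prod_div_prod _ _ _ S.injOn_ct_SC]
    refine Finset.sum_congr rfl fun t _ => ?_
    rw [CyclotomicMN.elemSymm_eq_esymm, CyclotomicMN.homSymm_eq_complHom]
    congr 2
    have := S.card_SC
    omega
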